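/- **Theorem 2.** Let $f$ be a probability density on $\mathbb R$ with $\int x^2f(x)\,dx<\infty$. For a function $g$ write $\|g\|^2=\int_{\mathbb R}|g(x)|^2\,dx\in[0,\infty]$. Let $Z_t=\sum_{j=1}^{N_t}X_j$, $t\ge 0$, be a compound Poisson process with intensity $1$ and jump density $f$: $N$ is a homogeneous Poisson process with intensity $1$, the $X_j$ are i.i.d. with density $f$, and $(X_j)_j$ is independent of $N$. Let $\phi(u)=\int e^{iux}f(x)\,dx=\mathbb E[e^{iuX_1}]$ and $\phi_\Delta(u)=\mathbb E[e^{iuZ_\Delta}]$, and for $m\ge 0$ let $f_m(x)=\frac1{2\pi}\int_{-m}^m e^{-iux}\phi(u)\,du$. For $n\in\mathbb N$ and $\Delta>0$ observe the increments $Y_{j\Delta}=Z_{j\Delta}-Z_{(j-1)\Delta}$, $j=1,\dots,n$, and put $$\hat\phi_{\Delta,n}(u)=\frac1n\sum_{j=1}^n e^{iuY_{j\Delta}},\qquad \hat\phi_n(u)=1+\frac1\Delta\int_0^u\frac{\hat\phi_{\Delta,n}'(z)}{\hat\phi_{\Delta,n}(z)}\,dz,\qquad \widetilde\phi_n(u)=\hat\phi_n(u)\mathbf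 1_{|\hat\phi_n(u)|\le 4},$$ where $\widetilde\phi_n(u):=0$ if the integral diverges (that is, if $\hat\phi_{\Delta,n}$ vanishes somewhere between $0$ and $u$), and $$\hat f_{m,\Delta}(x)=\frac1{2\pi}\int_{-m}^m e^{-iux}\,\widetilde\phi_n(u)\,du .$$ Then there is a constant $T_0$, depending only on $f$, such that for all $n\in\mathbb N$ and $\Delta>0$ with $n\Delta\ge T_0$ and $\Delta\le\frac14\log(n\Delta)$, and for all $m\ge 0$, $$\mathbb E\big[\|\hat f_{m,\Delta}-f\|^2\big]\le\|f_m-f\|^2+\frac{2}{n\Delta}\int_{-m}^m\frac{du}{|\phi_\Delta(u)|^2}+50\,\mathbb E[X_1^2]\,\frac{m}{n\Delta}+200\,\frac{m^2}{(n\Delta)^2}.$$ In particular, along any sequence $\Delta=\Delta_n$ (vanishing, fixed or slowly growing) with $\Delta_n\le\frac14\log(n\Delta_n)$ and $n\Delta_n\to\infty$, the bound holds for all sufficiently large $n$, simultaneously for all $m\ge 0$. -/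

import Mathlib

open MeasureTheory ProbabilityTheory
open scoped NNReal ENNReal

noncomputable section

namespace Decompounding

/-- `N` is a homogeneous Poisson process with intensity `lam` under `P`. The subtraction in `ℕ` is
harmless because almost every path is nondecreasing. -/
structure IsPoissonProcess {Ω : Type*} [MeasurableSpace Ω] (N : ℝ≥0 → Ω → ℕ) (lam : ℝ≥0)
    (P : Measure Ω) : Prop where
  measurable : ∀ t, Measurable (N t)
  zero : ∀ᵐ ω ∂P, N 0 ω = 0
  monotone : ∀ᵐ ω ∂P, Monotone fun t => N t ω
  right_continuous : ∀ᵐ ω ∂P, ∀ t, ContinuousWithinAt (fun s => N s ω) (Set.Ici t) t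
  indep_increments : HasIndepIncrements N P
  law_increments : ∀ s t : ℝ≥0, s ≤ t →
    P.map (fun ω => N t ω - N s ω) = poissonMeasure (lam * (t - s))

/-- The law on `ℝ` with Lebesgue density `f`. -/
def lawOfDensity (f : ℝ → ℝ) : Measure ℝ :=
  volume.withDensity fun x => ENNReal.ofReal (f x)

/-- `N` and `X` drive a compound Poisson process with intensity `lam` and jump density `f`:
`N` is a Poisson process with intensity `lam`, the `X j` are i.i.d. with density `f`, and the
sequence `X` is independent of the process `N`. -/
structure IsCompoundPoissonPair {Ω : Type*} [MeasurableSpace Ω] (N : ℝ≥0 → Ω → ℕ)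
    (X : ℕ → Ω → ℝ) (lam : ℝ≥0) (f : ℝ → ℝ) (P : Measure Ω) : Prop where
  poisson : IsPoissonProcess N lam P
  measurable_jump : ∀ j, Measurable (X j)
  indep_jumps : iIndepFun X P
  law_jump : ∀ j, P.map (X j) = lawOfDensity f
  indep : IndepFun (fun ω j => X j ω) (fun ω t => N t ω) P

/-- The compound Poisson process `Z_t`, the sum of the first `N_t` jumps (numbered from `0`). -/
def compoundProcess {Ω : Type*} (N : ℝ≥0 → Ω → ℕ) (X : ℕ → Ω → ℝ) (t : ℝ≥0) (ω : Ω) : ℝ :=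
  ∑ j ∈ Finset.range (N t ω), X j ω

/-- The `n` observed increments `Z_{(j+1)Δ} - Z_{jΔ}`, `j = 0, …, n - 1`. -/
def increments {Ω : Type*} (Z : ℝ≥0 → Ω → ℝ) (Δ : ℝ≥0) (n : ℕ) (ω : Ω) : Fin n → ℝ :=
  fun j => Z (((j : ℕ) + 1 : ℝ≥0) * Δ) ω - Z (((j : ℕ) : ℝ≥0) * Δ) ω

/-- The empirical characteristic function of the data `y`. -/
def ecf {n : ℕ} (y : Fin n → ℝ) (u : ℝ) : ℂ :=
  (n : ℂ)⁻¹ * ∑ j, Complex.exp (Complex.I * u * y j)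

/-- The derivative of the empirical characteristic function. -/
def ecfDeriv {n : ℕ} (y : Fin n → ℝ) (u : ℝ) : ℂ :=
  (n : ℂ)⁻¹ * ∑ j, Complex.I * y j * Complex.exp (Complex.I * u * y j)

/-- The distinguished logarithm of the empirical characteristic function. -/
def ecfLog {n : ℕ} (y : Fin n → ℝ) (u : ℝ) : ℂ :=
  ∫ z in (0 : ℝ)..u, ecfDeriv y z / ecf y z

/-- The estimator `1 + Log(ecf) / Δ` of the characteristic function of a jump. -/
def phiHat {n : ℕ} (Δ : ℝ) (y : Fin n → ℝ) (u : ℝ) : ℂ :=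
  1 + (Δ : ℂ)⁻¹ * ecfLog y u

open Classical in
/-- `phiHat` truncated at modulus `4`. It is also set to `0` where the integral defining the
distinguished logarithm diverges, i.e. where the empirical characteristic function has a zero
between `0` and `u`. -/
def phiTilde {n : ℕ} (Δ : ℝ) (y : Fin n → ℝ) (u : ℝ) : ℂ :=
  if IntervalIntegrable (fun z => ecfDeriv y z / ecf y z) volume 0 u ∧ ‖phiHat Δ y u‖ ≤ 4
  then phiHat Δ y u else 0

/-- Fourier inversion of `g` after cutting it off outside `[-m, m]`. -/
def cutoffInverse (g : ℝ → ℂ) (m x : ℝ) : ℂ :=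
  (2 * Real.pi : ℂ)⁻¹ * ∫ u in (-m)..m, Complex.exp (-(Complex.I * u * x)) * g u

/-- The spectral cutoff estimator of the jump density from the increments `y`. -/
def fHat {n : ℕ} (Δ : ℝ) (y : Fin n → ℝ) (m x : ℝ) : ℂ :=
  cutoffInverse (phiTilde Δ y) m x

/-- The Fourier transform of `f`, with kernel `e^{iux}`. -/
def fourierTransform (f : ℝ → ℝ) (u : ℝ) : ℂ :=
  ∫ x : ℝ, Complex.exp (Complex.I * u * x) * f x

/-- The function `f_m` whose Fourier transform is that of `f` restricted to `[-m, m]`. -/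
def fCut (f : ℝ → ℝ) (m x : ℝ) : ℂ :=
  cutoffInverse (fourierTransform f) m x

/-- The squared `L²(ℝ)` distance `‖g - f‖²`, as an element of `[0, ∞]`. -/
def sqDist (g : ℝ → ℂ) (f : ℝ → ℝ) : ℝ≥0∞ :=
  ∫⁻ x, ‖g x - (f x : ℂ)‖ₑ ^ 2

end Decompounding

end

/-! By Plancherel, the squared error is at most the squared bias `‖f_m - f‖²` plus `1/(2π)` times
the integral over `[-m, m]` of `|φ̃ - φ|²` (`sqDist_cutoffInverse_le`). If `f` is not square
integrable, the bias is infinite and nothing is left to prove.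

On the Fourier side write `ψ = exp (Δ (φ - 1))` for the characteristic function of an increment. As
long as the empirical characteristic function stays within `|ψ| / 2` of `ψ` between `0` and `u`, the
quotient of the two stays in a disc around `1`. The distinguished logarithm is then `Δ (φ - 1)` plus
the principal logarithm of this quotient, so the error at `u` is at most `3/(2Δ)` times the relative
error of the empirical characteristic function (`ecfLog_eq`, `norm_phiTilde_sub_le`). The variance
of the latter is at most `4Δ/n`, which yields `9/(nΔ|ψ|²)`.

Elsewhere truncation bounds the squared error by `25`, so only the probability of failure matters. A
Lipschitz bound and a grid reduce failure to two kinds of events. Either the total jump size is too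
large, which by Chebyshev has probability at most `E[X²]/(nΔ)`, or the deviation is large at a grid
point of `(0, |u|]`, which Hoeffding's inequality controls. Only grid points up to `|u|` count
against `u`, so the cost is linear in `|u|`, integrates to order `m²`, and the threshold does not
depend on `m`.

Hoeffding's bound must beat `|ψ|² ≥ exp (-2aΔ)` with `a = sup (1 - Re φ)`. A law with a density has
`a < 2` (`exists_one_sub_re_charFun_le`). With `Δ ≤ log (nΔ) / 4` the exponent is then at least of
order `(nΔ)^(1 - a/2) / Δ`, which dominates every multiple of `log (nΔ)` (`exists_threshold`). -/

namespace Decompounding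

/-! ### Plancherel and the bias term. -/

open scoped FourierTransform SchwartzMap in
/-- On `L¹ ∩ L²` the Fourier transform of `L²` is given by the Fourier integral. -/
lemma coeFn_fourier_toLp {h : ℝ → ℂ} (h1 : Integrable h) (h2 : MemLp h 2) :
    (𝓕 (h2.toLp h) : Lp ℂ 2 (volume : Measure ℝ)) =ᵐ[volume] 𝓕 h := by
  have hcont : Continuous (𝓕 h) :=
    VectorFourier.fourierIntegral_continuous Real.continuous_fourierChar continuous_inner h1
  -- Both sides are locally integrable, so it suffices that they agree as distributions; moving the
  -- transform onto a smooth compactly supported test function shows this.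
  refine ae_eq_of_integral_contDiff_smul_eq
    ((Lp.memLp _).locallyIntegrable (by norm_num)) hcont.locallyIntegrable fun g hg hgs => ?_
  have hg1 : HasCompactSupport (Complex.ofRealCLM ∘ g) := hgs.comp_left (by simp)
  have hg2 : ContDiff ℝ _ (Complex.ofRealCLM ∘ g) := Complex.ofRealCLM.contDiff.comp hg
  let ψ : 𝓢(ℝ, ℂ) := hg1.toSchwartzMap hg2
  have hψ : ∀ x, ψ x = (g x : ℂ) := fun x => rfl
  have e1 := congrArg (fun D => D ψ) (Lp.fourier_toTemperedDistribution_eq (h2.toLp h))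
  simp only [TemperedDistribution.fourier_apply, Lp.toTemperedDistribution_apply] at e1
  have e2 : ∫ ξ, (𝓕 (ψ : ℝ → ℂ)) ξ • h ξ = ∫ x, ψ x • 𝓕 h x := by
    simpa using! VectorFourier.integral_fourierIntegral_smul_eq_flip
      (L := innerₗ ℝ) Real.continuous_fourierChar continuous_inner ψ.integrable h1
  have e3 : ∫ ξ, (𝓕 ψ) ξ • (h2.toLp h) ξ = ∫ ξ, (𝓕 (ψ : ℝ → ℂ)) ξ • h ξ := by
    refine integral_congr_ae ?_
    filter_upwards [h2.coeFn_toLp] with x hx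
    rw [hx, SchwartzMap.fourier_coe]
  rw [e3, e2] at e1
  simpa [hψ] using e1.symm

open scoped FourierTransform SchwartzMap in
/-- On `L¹ ∩ L²` the inverse Fourier transform of `L²` is given by the inverse Fourier integral. -/
lemma coeFn_fourierInv_toLp {h : ℝ → ℂ} (h1 : Integrable h) (h2 : MemLp h 2) :
    (𝓕⁻ (h2.toLp h) : Lp ℂ 2 (volume : Measure ℝ)) =ᵐ[volume] 𝓕⁻ h := by
  have hcont : Continuous (𝓕⁻ h) :=
    VectorFourier.fourierIntegral_continuous Real.continuous_fourierChar
      (L := -innerₗ ℝ) (continuous_inner (𝕜 := ℝ) (E := ℝ)).neg h1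
  refine ae_eq_of_integral_contDiff_smul_eq
    ((Lp.memLp _).locallyIntegrable (by norm_num)) hcont.locallyIntegrable fun g hg hgs => ?_
  have hg1 : HasCompactSupport (Complex.ofRealCLM ∘ g) := hgs.comp_left (by simp)
  have hg2 : ContDiff ℝ _ (Complex.ofRealCLM ∘ g) := Complex.ofRealCLM.contDiff.comp hg
  let ψ : 𝓢(ℝ, ℂ) := hg1.toSchwartzMap hg2
  have hψ : ∀ x, ψ x = (g x : ℂ) := fun x => rfl
  have e1 := congrArg (fun D => D ψ) (Lp.fourierInv_toTemperedDistribution_eq (h2.toLp h))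
  simp only [TemperedDistribution.fourierInv_apply, Lp.toTemperedDistribution_apply] at e1
  have e2 : ∫ ξ, (𝓕⁻ (ψ : ℝ → ℂ)) ξ • h ξ = ∫ x, ψ x • 𝓕⁻ h x := by
    have hflip : (-innerₗ ℝ).flip = -innerₗ ℝ := by ext; simp
    have := VectorFourier.integral_fourierIntegral_smul_eq_flip
      (L := -innerₗ ℝ) Real.continuous_fourierChar (continuous_inner (𝕜 := ℝ) (E := ℝ)).neg
      (ψ.integrable (μ := volume)) h1
    rwa [hflip] at this
  have e3 : ∫ ξ, (𝓕⁻ ψ) ξ • (h2.toLp h) ξ = ∫ ξ, (𝓕⁻ (ψ : ℝ → ℂ)) ξ • h ξ := by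
    refine integral_congr_ae ?_
    filter_upwards [h2.coeFn_toLp] with x hx
    rw [hx, SchwartzMap.fourierInv_coe]
  rw [e3, e2] at e1
  simpa [hψ] using e1.symm

lemma lintegral_comp_two_pi_mul (F : ℝ → ℝ≥0∞) :
    ∫⁻ ξ, F (2 * Real.pi * ξ) = ENNReal.ofReal (2 * Real.pi)⁻¹ * ∫⁻ u, F u := by
  have h := Real.map_volume_mul_left (a := 2 * Real.pi) (by positivity)
  have e : MeasurableEmbedding (fun ξ : ℝ => 2 * Real.pi * ξ) :=
    (MeasurableEquiv.mulLeft₀ (2 * Real.pi) (by positivity)).measurableEmbedding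
  rw [← e.lintegral_map, h, lintegral_smul_measure, abs_of_pos (by positivity)]
  rfl

open scoped FourierTransform in
-- The substitution `u = 2πξ` absorbs the factor `1/(2π)` and passes from the kernel `e^{-iux}` to
-- `e^{-2πiξx}`.
lemma cutoffInverse_eq_fourier (g : ℝ → ℂ) {m : ℝ} (hm : 0 ≤ m) (x : ℝ) :
    cutoffInverse g m x =
      𝓕 (fun ξ : ℝ => (Set.Ioc (-m) m).indicator g (2 * Real.pi * ξ)) x := by
  rw [Real.fourier_real_eq_integral_exp_smul, cutoffInverse,
    intervalIntegral.integral_of_le (by linarith), ← integral_indicator measurableSet_Ioc]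
  have h := Measure.integral_comp_mul_left (fun u : ℝ => (Set.Ioc (-m) m).indicator
    (fun u : ℝ => Complex.exp (-(Complex.I * u * x)) * g u) u) (2 * Real.pi)
  rw [abs_of_pos (by positivity)] at h
  rw [show ((2 * Real.pi : ℂ)⁻¹) = (((2 * Real.pi)⁻¹ : ℝ) : ℂ) by push_cast; ring,
    ← Complex.real_smul, ← h]
  congr 1 with ξ
  by_cases hξ : 2 * Real.pi * ξ ∈ Set.Ioc (-m) m
  · simp only [Set.indicator_of_mem hξ, smul_eq_mul]
    congr 2
    push_cast; ring
  · simp [Set.indicator_of_notMem hξ]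

lemma memLp_indicator_comp_two_pi_mul {g : ℝ → ℂ} (hg : Measurable g) {C : ℝ}
    (hC : ∀ u, ‖g u‖ ≤ C) (m : ℝ) (p : ℝ≥0∞) :
    MemLp (fun ξ : ℝ => (Set.Ioc (-m) m).indicator g (2 * Real.pi * ξ)) p := by
  have hpre : (fun ξ : ℝ => (Set.Ioc (-m) m).indicator g (2 * Real.pi * ξ)) =
      ((fun ξ : ℝ => 2 * Real.pi * ξ) ⁻¹' Set.Ioc (-m) m).indicator
        (fun ξ : ℝ => g (2 * Real.pi * ξ)) := by
    ext ξ; simp [Set.indicator]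
  have hms : MeasurableSet ((fun ξ : ℝ => 2 * Real.pi * ξ) ⁻¹' Set.Ioc (-m) m) :=
    measurableSet_Ioc.preimage (by fun_prop)
  have hfin : volume ((fun ξ : ℝ => 2 * Real.pi * ξ) ⁻¹' Set.Ioc (-m) m) < ∞ := by
    rw [Real.volume_preimage_mul_left (by positivity)]
    exact ENNReal.mul_lt_top ENNReal.ofReal_lt_top (by simp)
  rw [hpre, memLp_indicator_iff_restrict hms]
  have : IsFiniteMeasure (volume.restrict ((fun ξ : ℝ => 2 * Real.pi * ξ) ⁻¹' Set.Ioc (-m) m)) :=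
    ⟨by simpa using hfin⟩
  exact MemLp.of_bound (hg.comp (by fun_prop)).aestronglyMeasurable C (ae_of_all _ fun ξ => hC _)

open scoped FourierTransform in
lemma memLp_cutoffInverse {g : ℝ → ℂ} (hg : Measurable g) {C : ℝ}
    (hC : ∀ u, ‖g u‖ ≤ C) {m : ℝ} (hm : 0 ≤ m) : MemLp (cutoffInverse g m) 2 := by
  have h1 := memLp_indicator_comp_two_pi_mul hg hC m 1
  have h2 := memLp_indicator_comp_two_pi_mul hg hC m 2
  have := coeFn_fourier_toLp (memLp_one_iff_integrable.1 h1) h2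
  rw [← funext (cutoffInverse_eq_fourier g hm)] at this
  exact (memLp_congr_ae this).1 (Lp.memLp _)

open scoped FourierTransform in
lemma fourierTransform_eq_fourierInv (f : ℝ → ℝ) (ξ : ℝ) :
    fourierTransform f (2 * Real.pi * ξ) = 𝓕⁻ (fun x => (f x : ℂ)) ξ := by
  rw [Real.fourierInv_eq', fourierTransform]
  congr 1 with x
  simp only [smul_eq_mul, RCLike.inner_apply, conj_trivial]
  congr 2
  push_cast; ring

open scoped FourierTransform in
/-- Plancherel's identity for the error of a spectral cutoff estimator. -/
lemma sqDist_cutoffInverse {f : ℝ → ℝ} (hf1 : Integrable f) (hf2 : MemLp f 2) {g : ℝ → ℂ}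
    (hg : Measurable g) {C : ℝ} (hC : ∀ u, ‖g u‖ ≤ C) {m : ℝ} (hm : 0 ≤ m) :
    sqDist (cutoffInverse g m) f = ENNReal.ofReal (2 * Real.pi)⁻¹ *
      ∫⁻ u, ‖(Set.Ioc (-m) m).indicator g u - fourierTransform f u‖ₑ ^ 2 := by
  set G : ℝ → ℂ := fun ξ : ℝ => (Set.Ioc (-m) m).indicator g (2 * Real.pi * ξ)
  have hG1 : Integrable G :=
    memLp_one_iff_integrable.1 (memLp_indicator_comp_two_pi_mul hg hC m 1)
  have hG2 : MemLp G 2 := memLp_indicator_comp_two_pi_mul hg hC m 2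
  have hF1 : Integrable (fun x => (f x : ℂ)) := hf1.ofReal
  have hF2 : MemLp (fun x => (f x : ℂ)) 2 := hf2.ofReal
  -- The Fourier transform is a linear isometry of `L²` with inverse `𝓕⁻`, so the difference can be
  -- measured before transforming.
  have key : ‖𝓕 (hG2.toLp G) - hF2.toLp _‖ₑ = ‖hG2.toLp G - 𝓕⁻ (hF2.toLp _)‖ₑ := by
    rw [← ofReal_norm, ← ofReal_norm, ← Lp.norm_fourier_eq (hG2.toLp G - 𝓕⁻ (hF2.toLp _)),
      sub_eq_add_neg (hG2.toLp G), FourierTransform.fourier_add, FourierTransform.fourier_neg,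
      ← sub_eq_add_neg, FourierTransform.fourier_fourierInv_eq]
  rw [← lintegral_comp_two_pi_mul
    (fun u => ‖(Set.Ioc (-m) m).indicator g u - fourierTransform f u‖ₑ ^ 2), sqDist]
  have hsq : ∀ w : Lp ℂ 2 (volume : Measure ℝ), ‖w‖ₑ ^ 2 = ∫⁻ x, ‖w x‖ₑ ^ 2 := by
    intro w
    rw [Lp.enorm_def, eLpNorm_eq_lintegral_rpow_enorm_toReal (by simp) (by simp),
      ← ENNReal.rpow_natCast, ← ENNReal.rpow_mul]
    simp
  have e1 := hsq (𝓕 (hG2.toLp G) - hF2.toLp _)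
  have e2 := hsq (hG2.toLp G - 𝓕⁻ (hF2.toLp _))
  rw [key, e2] at e1
  refine Eq.trans (lintegral_congr_ae ?_) (e1.symm.trans (lintegral_congr_ae ?_))
  · filter_upwards [Lp.coeFn_sub (𝓕 (hG2.toLp G)) (hF2.toLp _), coeFn_fourier_toLp hG1 hG2,
      hF2.coeFn_toLp] with x h1 h2 h3
    rw [h1, Pi.sub_apply, h2, h3, cutoffInverse_eq_fourier g hm]
  · filter_upwards [Lp.coeFn_sub (hG2.toLp G) (𝓕⁻ (hF2.toLp _)), coeFn_fourierInv_toLp hF1 hF2,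
      hG2.coeFn_toLp] with x h1 h2 h3
    rw [h1, Pi.sub_apply, h2, h3, fourierTransform_eq_fourierInv]

/-- Since `f_m` is in `L²`, a finite distance would put `f` in `L²`. This is why the main bound
needs no square integrability of `f`. -/
lemma sqDist_fCut_eq_top {f : ℝ → ℝ} (hf1 : Integrable f) (hf2 : ¬ MemLp f 2)
    (hφ : Measurable (fourierTransform f)) {C : ℝ} (hC : ∀ u, ‖fourierTransform f u‖ ≤ C)
    {m : ℝ} (hm : 0 ≤ m) : sqDist (fCut f m) f = ∞ := by
  by_contra htop
  refine hf2 ?_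
  have h1 : MemLp (fCut f m) 2 := memLp_cutoffInverse hφ hC hm
  have h2 : MemLp (fun x => fCut f m x - (f x : ℂ)) 2 := by
    refine ⟨h1.1.sub hf1.ofReal.1, ?_⟩
    rw [eLpNorm_lt_top_iff_lintegral_rpow_enorm_lt_top (by simp) (by simp)]
    simpa [sqDist, lt_top_iff_ne_top] using htop
  have h3 : MemLp (fun x => (f x : ℂ)) 2 := by
    convert h1.sub h2 using 1
    ext x
    simp
  simpa using h3.re

/-- The squared error of a spectral cutoff estimator is at most the squared bias plus the squared
error on the Fourier side. -/
lemma sqDist_cutoffInverse_le {f : ℝ → ℝ} (hf1 : Integrable f)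
    (hφ : Measurable (fourierTransform f)) {C : ℝ} (hφC : ∀ u, ‖fourierTransform f u‖ ≤ C)
    {g : ℝ → ℂ} (hg : Measurable g) {D : ℝ} (hD : ∀ u, ‖g u‖ ≤ D) {m : ℝ} (hm : 0 ≤ m) :
    sqDist (cutoffInverse g m) f ≤ sqDist (fCut f m) f + ENNReal.ofReal (2 * Real.pi)⁻¹ *
      ∫⁻ u in Set.Ioc (-m) m, ‖g u - fourierTransform f u‖ₑ ^ 2 := by
  by_cases hf2 : MemLp f 2
  · rw [show fCut f m = cutoffInverse (fourierTransform f) m from rfl,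
      sqDist_cutoffInverse hf1 hf2 hg hD hm,
      sqDist_cutoffInverse hf1 hf2 hφ hφC hm,
      ← mul_add, ← lintegral_indicator measurableSet_Ioc]
    gcongr
    rw [← lintegral_add_right]
    · refine lintegral_mono fun u => ?_
      by_cases hu : u ∈ Set.Ioc (-m) m
      · simp [hu]
      · simp [hu]
    · exact ((hg.sub hφ).enorm.pow_const 2).indicator measurableSet_Ioc
  · simp [sqDist_fCut_eq_top hf1 hf2 hφ hφC hm]

/-! ### Characteristic function of the jump law. -/

section JumpLaw

variable {f : ℝ → ℝ}

lemma isProbabilityMeasure_lawOfDensity (hf_nonneg : ∀ x, 0 ≤ f x) (hf_one : ∫ x, f x = 1) :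
    IsProbabilityMeasure (lawOfDensity f) := by
  refine ⟨?_⟩
  rw [lawOfDensity, withDensity_apply _ MeasurableSet.univ, Measure.restrict_univ,
    ← ofReal_integral_eq_lintegral_ofReal (integrable_of_integral_eq_one hf_one)
      (ae_of_all _ hf_nonneg), hf_one, ENNReal.ofReal_one]

lemma integral_lawOfDensity {E : Type*} [NormedAddCommGroup E] [NormedSpace ℝ E]
    (hf_meas : Measurable f) (hf_nonneg : ∀ x, 0 ≤ f x) (g : ℝ → E) :
    ∫ x, g x ∂(lawOfDensity f) = ∫ x, f x • g x := by
  rw [lawOfDensity, integral_withDensity_eq_integral_toReal_smul hf_meas.ennreal_ofReal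
    (ae_of_all _ fun x => ENNReal.ofReal_lt_top)]
  simp [ENNReal.toReal_ofReal (hf_nonneg _)]

lemma integrable_lawOfDensity_iff {E : Type*} [NormedAddCommGroup E] [NormedSpace ℝ E]
    (hf_meas : Measurable f) (hf_nonneg : ∀ x, 0 ≤ f x) (g : ℝ → E) :
    Integrable g (lawOfDensity f) ↔ Integrable fun x => f x • g x := by
  rw [lawOfDensity, integrable_withDensity_iff_integrable_smul' hf_meas.ennreal_ofReal
    (ae_of_all _ fun x => ENNReal.ofReal_lt_top)]
  simp [ENNReal.toReal_ofReal (hf_nonneg _)]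

lemma fourierTransform_eq_charFun (hf_meas : Measurable f) (hf_nonneg : ∀ x, 0 ≤ f x) :
    fourierTransform f = charFun (lawOfDensity f) := by
  ext u
  rw [charFun_apply_real, integral_lawOfDensity hf_meas hf_nonneg, fourierTransform]
  congr 1 with x
  rw [Complex.real_smul, mul_comm]
  congr 2
  ring

lemma memLp_id_lawOfDensity (hf_meas : Measurable f) (hf_nonneg : ∀ x, 0 ≤ f x)
    (hf_sq : Integrable fun x => x ^ 2 * f x) : MemLp id 2 (lawOfDensity f) := by
  rw [memLp_two_iff_integrable_sq (by fun_prop), integrable_lawOfDensity_iff hf_meas hf_nonneg]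
  simpa [mul_comm] using hf_sq

lemma integral_sq_lawOfDensity (hf_meas : Measurable f) (hf_nonneg : ∀ x, 0 ≤ f x) :
    ∫ x, x ^ 2 ∂(lawOfDensity f) = ∫ x, x ^ 2 * f x := by
  rw [integral_lawOfDensity hf_meas hf_nonneg]
  simp [mul_comm]

lemma hasDerivAt_charFun {ν : Measure ℝ} [IsProbabilityMeasure ν] (hν : MemLp id 1 ν) (u : ℝ) :
    HasDerivAt (charFun ν) (Complex.I * ∫ x, x * Complex.exp (u * x * Complex.I) ∂ν) u := by
  have hd : Differentiable ℝ (charFun ν) :=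
    (contDiff_charFun (n := 1) (by simpa using hν)).differentiable (by norm_num)
  have := iteratedDeriv_charFun (n := 1) (t := u) (μ := ν) (by simpa using hν)
  rw [iteratedDeriv_one] at this
  simpa [this] using (hd u).hasDerivAt

lemma norm_deriv_charFun_le {ν : Measure ℝ} (u : ℝ) :
    ‖Complex.I * ∫ x, x * Complex.exp (u * x * Complex.I) ∂ν‖ ≤ ∫ x, |x| ∂ν := by
  rw [norm_mul, Complex.norm_I, one_mul]
  refine (norm_integral_le_integral_norm _).trans_eq ?_
  congr 1 with x
  rw [norm_mul, ← Complex.ofReal_mul, Complex.norm_exp_ofReal_mul_I]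
  simp

/-- The characteristic function of a compound Poisson variable is Lipschitz. -/
lemma norm_cexp_charFun_sub_le {ν : Measure ℝ} [IsProbabilityMeasure ν] (hν : MemLp id 1 ν)
    {Δ : ℝ} (hΔ : 0 ≤ Δ) (u v : ℝ) :
    ‖Complex.exp (Δ * (charFun ν u - 1)) - Complex.exp (Δ * (charFun ν v - 1))‖
      ≤ Δ * (∫ x, |x| ∂ν) * |u - v| := by
  have h : ∀ x ∈ (Set.univ : Set ℝ), HasDerivWithinAt
      (fun u : ℝ => Complex.exp (Δ * (charFun ν u - 1)))
      (Complex.exp (Δ * (charFun ν x - 1)) *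
        (Δ * (Complex.I * ∫ y, y * Complex.exp (x * y * Complex.I) ∂ν))) Set.univ x := fun x _ =>
    (((hasDerivAt_charFun hν x).sub_const 1).const_mul (Δ : ℂ)).cexp.hasDerivWithinAt
  refine Convex.norm_image_sub_le_of_norm_hasDerivWithin_le h (fun x _ => ?_) convex_univ
    (Set.mem_univ v) (Set.mem_univ u)
  rw [norm_mul, norm_mul, Complex.norm_exp, Complex.norm_real, Real.norm_of_nonneg hΔ]
  have h1 : Real.exp ((Δ : ℂ) * (charFun ν x - 1)).re ≤ 1 := by
    rw [Real.exp_le_one_iff, Complex.re_ofReal_mul]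
    have := (Complex.re_le_norm (charFun ν x)).trans (norm_charFun_le_one x)
    simp only [Complex.sub_re, Complex.one_re]
    nlinarith
  calc _ ≤ 1 * (Δ * ∫ x, |x| ∂ν) := by
        gcongr
        exact norm_deriv_charFun_le x
    _ = _ := one_mul _

/-- `1 + Re φ(u)` is the mean of `1 + cos (ux)`, which is nonnegative and vanishes only on a
countable set, a null set for a law with a density. -/
lemma neg_one_lt_re_charFun_lawOfDensity (hf_nonneg : ∀ x, 0 ≤ f x)
    (hf_one : ∫ x, f x = 1) (u : ℝ) : -1 < (charFun (lawOfDensity f) u).re := by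
  have := isProbabilityMeasure_lawOfDensity hf_nonneg hf_one
  set ν := lawOfDensity f
  have hint : Integrable (fun x : ℝ => Real.cos (u * x)) ν :=
    Integrable.of_bound (by fun_prop) 1 (ae_of_all _ fun x => Real.abs_cos_le_one _)
  have hre : (charFun ν u).re = ∫ x, Real.cos (u * x) ∂ν := by
    rw [charFun_apply_real, ← RCLike.re_eq_complex_re, ← integral_re]
    · congr 1 with x
      rw [RCLike.re_eq_complex_re, ← Complex.ofReal_mul, Complex.exp_ofReal_mul_I_re]
    · refine Integrable.of_bound (by fun_prop) 1 (ae_of_all _ fun x => ?_)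
      rw [← Complex.ofReal_mul, Complex.norm_exp_ofReal_mul_I]
  have hpos : 0 < ∫ x, (1 + Real.cos (u * x)) ∂ν := by
    have hnn : 0 ≤ fun x : ℝ => 1 + Real.cos (u * x) := fun x => by
      simp only [Pi.zero_apply]
      linarith [Real.neg_one_le_cos (u * x)]
    rw [integral_pos_iff_support_of_nonneg hnn ((integrable_const 1).add hint), pos_iff_ne_zero]
    intro h0
    have hcount : Set.Countable (Function.support fun x : ℝ => 1 + Real.cos (u * x))ᶜ := by
      rcases eq_or_ne u 0 with rfl | hu
      · simp [Function.support]
      · refine (Set.countable_range fun k : ℤ => (Real.pi + k * (2 * Real.pi)) / u).mono ?_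
        intro x hx
        have hx' : Real.cos (u * x) = -1 := by
          simp only [Set.mem_compl_iff, Function.mem_support, not_not] at hx
          linarith
        obtain ⟨k, hk⟩ := Real.cos_eq_neg_one_iff.1 hx'
        exact ⟨k, by simp only [hk]; field_simp⟩
    have h1 : ν (Function.support fun x : ℝ => 1 + Real.cos (u * x))ᶜ = 0 :=
      withDensity_absolutelyContinuous _ _ (hcount.measure_zero volume)
    have := measure_union_null h0 h1
    rw [Set.union_compl_self, measure_univ] at this
    exact one_ne_zero this
  rw [integral_add (integrable_const _) hint] at hpos
  simp at hpos
  linarith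

/-- The Riemann–Lebesgue lemma, after rescaling the frequency. -/
lemma tendsto_charFun_lawOfDensity (hf_meas : Measurable f) (hf_nonneg : ∀ x, 0 ≤ f x) :
    Filter.Tendsto (charFun (lawOfDensity f)) (Filter.cocompact ℝ) (nhds 0) := by
  have h := Real.zero_at_infty_fourier (fun x => (f x : ℂ))
  have h2 := h.comp (Homeomorph.mulLeft₀ (-(2 * Real.pi)⁻¹)
    (by simp [Real.pi_ne_zero])).isClosedEmbedding.tendsto_cocompact
  refine h2.congr fun u => ?_
  rw [← fourierTransform_eq_charFun hf_meas hf_nonneg, Function.comp_apply,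
    Real.fourier_real_eq_integral_exp_smul, fourierTransform]
  congr 1 with x
  have := Real.pi_ne_zero
  rw [smul_eq_mul]
  congr 2
  simp
  field_simp

/-- A jump density keeps the real part of its characteristic function away from `-1`. -/
lemma exists_one_sub_re_charFun_le (hf_meas : Measurable f) (hf_nonneg : ∀ x, 0 ≤ f x)
    (hf_one : ∫ x, f x = 1) :
    ∃ a : ℝ, 0 < a ∧ a < 2 ∧ ∀ u, 1 - (charFun (lawOfDensity f) u).re ≤ a := by
  have := isProbabilityMeasure_lawOfDensity hf_nonneg hf_one
  have hev : ∀ᶠ u in Filter.cocompact ℝ, ‖charFun (lawOfDensity f) u‖ < 1 / 2 := by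
    have := (tendsto_charFun_lawOfDensity hf_meas hf_nonneg).norm
    rw [norm_zero] at this
    exact this.eventually_lt_const (by norm_num)
  -- Outside the compact set `K` the bound `3/2` works; on `K` a continuous function that is
  -- pointwise below `2` attains its maximum. The point `0` is added to keep the set nonempty.
  obtain ⟨K, hK, hKs⟩ := Filter.mem_cocompact.1 hev
  have hcont : Continuous fun u => 1 - (charFun (lawOfDensity f) u).re :=
    continuous_const.sub (Complex.continuous_re.comp continuous_charFun)
  obtain ⟨v, -, hv⟩ := (hK.insert 0).exists_isMaxOn (Set.insert_nonempty _ _) hcont.continuousOn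
  refine ⟨max (3 / 2) (1 - (charFun (lawOfDensity f) v).re), by positivity, ?_, fun u => ?_⟩
  · rw [max_lt_iff]
    exact ⟨by norm_num, by linarith [neg_one_lt_re_charFun_lawOfDensity hf_nonneg hf_one v]⟩
  · by_cases hu : u ∈ K
    · exact (hv (Set.mem_insert_of_mem _ hu)).trans (le_max_right _ _)
    · have h1 : ‖charFun (lawOfDensity f) u‖ < 1 / 2 := hKs hu
      have h2 := Complex.abs_re_le_norm (charFun (lawOfDensity f) u)
      exact le_max_of_le_left (by linarith [neg_abs_le (charFun (lawOfDensity f) u).re])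

end JumpLaw

/-! ### Poisson moments. -/

section Poisson

lemma integral_pow_poissonMeasure (r : ℝ≥0) (z : ℂ) :
    ∫ k, z ^ k ∂(poissonMeasure r) = Complex.exp (r * (z - 1)) := by
  rw [integral_poissonMeasure]
  have h := (NormedSpace.expSeries_div_hasSum_exp ((r : ℂ) * z)).mul_left (Complex.exp (-r))
  rw [← Complex.exp_eq_exp_ℂ, ← Complex.exp_add] at h
  rw [show (r : ℂ) * (z - 1) = -r + r * z by ring, ← h.tsum_eq]
  congr 1 with k
  rw [Complex.real_smul, mul_pow]
  push_cast
  ring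

/-- The identity `E[N g(N)] = r E[g(N + 1)]` for a Poisson variable `N` with mean `r`. -/
lemma hasSum_poisson_mul {r : ℝ≥0} {g : ℕ → ℝ} {s : ℝ}
    (h : HasSum (fun k : ℕ => Real.exp (-r) * r ^ k / (k.factorial : ℝ) * g (k + 1)) s) :
    HasSum (fun k : ℕ => Real.exp (-r) * r ^ k / (k.factorial : ℝ) * (k * g k)) (r * s) := by
  rw [← hasSum_nat_add_iff' 1]
  simp only [Finset.sum_range_one, Nat.cast_zero, zero_mul, mul_zero, sub_zero]
  refine (h.mul_left (r : ℝ)).congr_fun fun k => ?_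
  rw [Nat.factorial_succ]
  push_cast
  field_simp
  ring

/-- The integrand is the second moment, about `r c`, of a sum of `k` independent terms with mean `c`
and variance `b`. Its average comes from applying `hasSum_poisson_mul` twice to get the factorial
moments. -/
lemma lintegral_affine_add_sq_poissonMeasure (r : ℝ≥0) {b c : ℝ} (hb : 0 ≤ b) :
    ∫⁻ k, ENNReal.ofReal (b * k + c ^ 2 * (k - r) ^ 2) ∂(poissonMeasure r)
      = ENNReal.ofReal (r * (b + c ^ 2)) := by
  have h0 := hasSum_one_poissonMeasure r
  have h1 : HasSum (fun k : ℕ => Real.exp (-r) * r ^ k / (k.factorial : ℝ) * (k * 1)) (r * 1) :=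
    hasSum_poisson_mul (g := fun _ => 1) (by simpa using h0)
  have h2 : HasSum (fun k : ℕ => Real.exp (-r) * r ^ k / (k.factorial : ℝ) * (k * (k - 1)))
      (r * (r * 1)) :=
    hasSum_poisson_mul (g := fun k => (k : ℝ) - 1) (by simpa using h1)
  have h3 : HasSum (fun k : ℕ => Real.exp (-r) * r ^ k / (k.factorial : ℝ) *
      (b * k + c ^ 2 * (k - r) ^ 2)) (r * (b + c ^ 2)) := by
    have := ((h2.add (h1.mul_left (1 - 2 * (r : ℝ)))).add (h0.mul_left ((r : ℝ) ^ 2))).mul_left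
      (c ^ 2) |>.add (h1.mul_left b)
    convert! this using 1
    · ext k; ring
    · ring
  have hnn : ∀ k : ℕ, 0 ≤ b * k + c ^ 2 * ((k : ℝ) - r) ^ 2 := fun k => by positivity
  have hint : Integrable (fun k : ℕ => b * k + c ^ 2 * ((k : ℝ) - r) ^ 2) (poissonMeasure r) := by
    rw [integrable_poissonMeasure_iff]
    simpa only [Real.norm_of_nonneg (hnn _)] using h3.summable
  rw [← ofReal_integral_eq_lintegral_ofReal hint (ae_of_all _ hnn)]
  congr 1
  exact (hasSum_integral_poissonMeasure hint).unique (by simpa only [smul_eq_mul] using h3)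

end Poisson

/-! ### Conditioning on an independent variable. -/

section Conditioning

variable {Ω α β : Type*} [MeasurableSpace Ω] [MeasurableSpace α] [MeasurableSpace β]
  {P : Measure Ω} [IsProbabilityMeasure P] {A : Ω → α} {B : Ω → β}

/-- Fubini for the product law: `B` is frozen at `ω'` while `A` is averaged. In the application `A`
is the jump sequence and `B` the Poisson counts. -/
lemma integral_comp_of_indepFun (hA : Measurable A) (hB : Measurable B) (h : IndepFun A B P)
    {G : α × β → ℂ} (hG : Measurable G) {C : ℝ} (hC : ∀ p, ‖G p‖ ≤ C) :
    ∫ ω, G (A ω, B ω) ∂P = ∫ ω', ∫ ω, G (A ω, B ω') ∂P ∂P := by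
  have := Measure.isProbabilityMeasure_map (μ := P) hA.aemeasurable
  have := Measure.isProbabilityMeasure_map (μ := P) hB.aemeasurable
  rw [← integral_map (f := G) (hA.prodMk hB).aemeasurable hG.aestronglyMeasurable,
    (indepFun_iff_map_prod_eq_prod_map_map hA.aemeasurable hB.aemeasurable).1 h,
    integral_prod_symm _ (Integrable.of_bound hG.aestronglyMeasurable C (ae_of_all _ hC)),
    integral_map hB.aemeasurable
      (hG.stronglyMeasurable.integral_prod_left').aestronglyMeasurable]
  congr 1 with ω'
  have hGω : Measurable fun x => G (x, B ω') := hG.comp (by fun_prop)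
  rw [integral_map hA.aemeasurable hGω.aestronglyMeasurable]

lemma lintegral_comp_of_indepFun (hA : Measurable A) (hB : Measurable B) (h : IndepFun A B P)
    {G : α × β → ℝ≥0∞} (hG : Measurable G) :
    ∫⁻ ω, G (A ω, B ω) ∂P = ∫⁻ ω', ∫⁻ ω, G (A ω, B ω') ∂P ∂P := by
  have := Measure.isProbabilityMeasure_map (μ := P) hA.aemeasurable
  have := Measure.isProbabilityMeasure_map (μ := P) hB.aemeasurable
  rw [← lintegral_map (f := G) hG (hA.prodMk hB),
    (indepFun_iff_map_prod_eq_prod_map_map hA.aemeasurable hB.aemeasurable).1 h,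
    lintegral_prod_symm _ hG.aemeasurable, lintegral_map hG.lintegral_prod_left' hB]
  congr 1 with ω'
  have hGω : Measurable fun x => G (x, B ω') := hG.comp (by fun_prop)
  rw [lintegral_map hGω hA]

end Conditioning

lemma measurable_sum_range : Measurable fun p : (ℕ → ℝ) × ℕ => ∑ i ∈ Finset.range p.2, p.1 i :=
  measurable_from_prod_countable_left fun k => by
    dsimp only
    fun_prop

/-! ### Increments of the compound Poisson process. -/

section CompoundPoisson

variable {Ω : Type*} [MeasurableSpace Ω] {P : Measure Ω}
  {N : ℝ≥0 → Ω → ℕ} {X : ℕ → Ω → ℝ} {f : ℝ → ℝ}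

lemma measurable_compoundProcess (h : IsCompoundPoissonPair N X 1 f P) (t : ℝ≥0) :
    Measurable (compoundProcess N X t) :=
  measurable_sum_range.comp
    ((measurable_pi_lambda _ h.measurable_jump).prodMk (h.poisson.measurable t))

lemma measurable_increments (h : IsCompoundPoissonPair N X 1 f P) (Δ : ℝ≥0) (n : ℕ) (j : Fin n) :
    Measurable fun ω => increments (compoundProcess N X) Δ n ω j :=
  (measurable_compoundProcess h _).sub (measurable_compoundProcess h _)

/-- The increments of a compound Poisson process are dominated by the sum of all jump sizes. -/
lemma sum_abs_increments_le (h : IsCompoundPoissonPair N X 1 f P) (Δ : ℝ≥0) (n : ℕ) :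
    ∀ᵐ ω ∂P, ∑ j, |increments (compoundProcess N X) Δ n ω j|
      ≤ ∑ i ∈ Finset.range (N (n * Δ) ω), |X i ω| := by
  filter_upwards [h.poisson.monotone] with ω hω
  let S : ℕ → ℝ := fun j => ∑ i ∈ Finset.range (N (j * Δ) ω), |X i ω|
  have hS0 : 0 ≤ S 0 := Finset.sum_nonneg fun _ _ => abs_nonneg _
  have key : ∀ j : Fin n, |increments (compoundProcess N X) Δ n ω j| ≤ S (j + 1) - S j := by
    intro j
    have hle : N ((j : ℕ) * Δ) ω ≤ N (((j : ℕ) + 1) * Δ) ω := hω (by gcongr; simp)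
    simp only [increments, compoundProcess, S]
    push_cast
    rw [← Finset.sum_Ico_eq_sub _ hle, ← Finset.sum_Ico_eq_sub _ hle]
    exact Finset.abs_sum_le_sum_abs _ _
  calc _ ≤ ∑ j : Fin n, (S (j + 1) - S j) := Finset.sum_le_sum fun j _ => key j
    _ = S n - S 0 := by
      rw [Fin.sum_univ_eq_sum_range (fun j => S (j + 1) - S j), Finset.sum_range_sub]
    _ ≤ _ := by linarith

/-- For i.i.d. variables, sums over consecutive blocks of indices are independent. -/
lemma integral_prod_cexp_block_sums {ν : Measure ℝ} (hX : ∀ i, Measurable (X i))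
    (hind : iIndepFun X P) (hlaw : ∀ i, P.map (X i) = ν) {k : ℕ → ℕ} (hk : Monotone k) (n : ℕ)
    (u : Fin n → ℝ) :
    ∫ ω, ∏ j : Fin n, Complex.exp (u j * (∑ i ∈ Finset.range (k (j + 1)), X i ω
        - ∑ i ∈ Finset.range (k j), X i ω : ℝ) * Complex.I) ∂P
      = ∏ j : Fin n, charFun ν (u j) ^ (k (j + 1) - k j) := by
  -- Flatten the blocks into one index type. They are disjoint, so `g` is injective and the jumps
  -- indexed by it remain independent.
  let g : (Σ j : Fin n, Finset.Ico (k j) (k (j + 1))) → ℕ := fun p => p.2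
  have hg : Function.Injective g := by
    rintro ⟨j, i, hi⟩ ⟨j', i', hi'⟩ (rfl : i = i')
    have : j = j' := by
      simp only [Finset.mem_Ico] at hi hi'
      rcases lt_trichotomy j j' with h | h | h
      · have := hk (Nat.succ_le_of_lt (Fin.lt_def.1 h))
        simp only [Nat.succ_eq_add_one] at this
        omega
      · exact h
      · have := hk (Nat.succ_le_of_lt (Fin.lt_def.1 h))
        simp only [Nat.succ_eq_add_one] at this
        omega
    subst this
    rfl
  have h1 := (hind.precomp hg).integral_fun_prod_comp (𝕜 := ℂ)
    (f := fun p (x : ℝ) => Complex.exp (u (Sigma.fst p) * x * Complex.I))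
    (fun p => (hX (g p)).aemeasurable) (fun p => by fun_prop)
  have h2 : ∀ (j : Fin n) (i : ℕ),
      ∫ ω, Complex.exp (u j * X i ω * Complex.I) ∂P = charFun ν (u j) := by
    intro j i
    rw [← hlaw i, charFun_apply_real, integral_map (hX i).aemeasurable (by fun_prop)]
  simp only [Fintype.prod_sigma, g, h2] at h1
  calc _ = _ := ?_
    _ = _ := h1
    _ = _ := ?_
  · congr 1 with ω
    refine Finset.prod_congr rfl fun j _ => ?_
    rw [← Finset.sum_Ico_eq_sub _ (hk (Nat.le_succ _)),
      Finset.prod_coe_sort (Finset.Ico (k j) (k (j + 1)))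
        (fun i => Complex.exp (u j * X i ω * Complex.I)), ← Complex.exp_sum]
    push_cast
    rw [Finset.mul_sum, Finset.sum_mul]
  · refine Finset.prod_congr rfl fun j _ => ?_
    simp

variable [IsProbabilityMeasure P]

/-- The joint characteristic function of the increments of a compound Poisson process. -/
lemma integral_prod_cexp_increments (h : IsCompoundPoissonPair N X 1 f P) (Δ : ℝ≥0) (n : ℕ)
    (u : Fin n → ℝ) :
    ∫ ω, ∏ j : Fin n, Complex.exp (u j * (increments (compoundProcess N X) Δ n ω j : ℝ)
        * Complex.I) ∂P
      = ∏ j : Fin n, Complex.exp (Δ * (charFun (lawOfDensity f) (u j) - 1)) := by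
  have hlawprob : IsProbabilityMeasure (lawOfDensity f) := by
    rw [← h.law_jump 0]
    exact Measure.isProbabilityMeasure_map (h.measurable_jump 0).aemeasurable
  let t : ℕ → ℝ≥0 := fun j => j * Δ
  have ht : Monotone t := fun i j hij => by
    simp only [t]
    gcongr
  let V : Ω → ℕ → ℕ := fun ω j => N (t j) ω
  have hV : Measurable V := measurable_pi_lambda _ fun j => h.poisson.measurable _
  have hXm : Measurable fun ω j => X j ω := measurable_pi_lambda _ h.measurable_jump
  have hXV : IndepFun (fun ω j => X j ω) V P :=
    h.indep.comp measurable_id (measurable_pi_lambda (fun (x : ℝ≥0 → ℕ) (j : ℕ) => x (t j))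
      fun j => measurable_pi_apply _)
  let G : (ℕ → ℝ) × (ℕ → ℕ) → ℂ := fun p => ∏ j : Fin n, Complex.exp
    (u j * (∑ i ∈ Finset.range (p.2 (j + 1)), p.1 i - ∑ i ∈ Finset.range (p.2 j), p.1 i : ℝ)
      * Complex.I)
  have hS : ∀ j : ℕ, Measurable fun p : (ℕ → ℝ) × (ℕ → ℕ) => ∑ i ∈ Finset.range (p.2 j), p.1 i :=
    fun j => measurable_sum_range.comp (measurable_fst.prodMk
      ((measurable_pi_apply j).comp measurable_snd))
  have hG : Measurable G := by
    refine Finset.measurable_prod _ fun j _ => ?_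
    have h1 := hS (j + 1)
    have h2 := hS j
    fun_prop
  have hGC : ∀ p, ‖G p‖ ≤ 1 := fun p => by
    simp only [G, norm_prod, ← Complex.ofReal_mul, Complex.norm_exp_ofReal_mul_I]
    simp
  have e1 : ∀ ω, ∏ j : Fin n, Complex.exp (u j *
      (increments (compoundProcess N X) Δ n ω j : ℝ) * Complex.I) = G (fun j => X j ω, V ω) := by
    intro ω
    simp [G, V, t, increments, compoundProcess]
  simp_rw [e1]
  -- With the counts frozen, the increments are block sums of jumps; averaging over the jumps leaves
  -- powers of `φ` with the count increments as exponents. These are independent and Poisson, so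
  -- their generating functions finish the computation.
  rw [integral_comp_of_indepFun hXm hV hXV hG hGC]
  have e2 : ∀ᵐ ω' ∂P, ∫ ω, G (fun j => X j ω, V ω') ∂P
      = ∏ j : Fin n, charFun (lawOfDensity f) (u j) ^ (N (t (j + 1)) ω' - N (t j) ω') := by
    filter_upwards [h.poisson.monotone] with ω' hω'
    exact integral_prod_cexp_block_sums h.measurable_jump h.indep_jumps h.law_jump
      (k := V ω') (hω'.comp ht) n u
  rw [integral_congr_ae e2]
  have hm : ∀ j : ℕ, Measurable fun ω => N (t (j + 1)) ω - N (t j) ω := fun j =>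
    (h.poisson.measurable _).sub (h.poisson.measurable _)
  have hind := (h.poisson.indep_increments.nat ht).precomp (g := fun j : Fin n => (j : ℕ))
    Fin.val_injective
  have e3 := hind.integral_fun_prod_comp (𝕜 := ℂ)
    (f := fun j k => charFun (lawOfDensity f) (u j) ^ k)
    (fun j => (hm j).aemeasurable) (fun j => by fun_prop)
  refine e3.trans (Finset.prod_congr rfl fun j _ => ?_)
  have hlaw : P.map (fun ω => N (t (j + 1)) ω - N (t j) ω) = poissonMeasure Δ := by
    rw [h.poisson.law_increments _ _ (ht (Nat.le_succ j))]
    congr 1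
    simp only [t]
    push_cast
    rw [one_mul, add_mul, one_mul, add_tsub_cancel_left]
  rw [← integral_pow_poissonMeasure, ← hlaw, integral_map (hm j).aemeasurable (by fun_prop)]

/-- Evaluate the joint characteristic function at a vector supported on the coordinate `j`; the
other factors are `1` because `φ(0) = 1`. -/
lemma charFun_increments (h : IsCompoundPoissonPair N X 1 f P) (Δ : ℝ≥0) (n : ℕ) (j : Fin n)
    (u : ℝ) : charFun (P.map fun ω => increments (compoundProcess N X) Δ n ω j) u
      = Complex.exp (Δ * (charFun (lawOfDensity f) u - 1)) := by
  have hlawprob : IsProbabilityMeasure (lawOfDensity f) := by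
    rw [← h.law_jump 0]
    exact Measure.isProbabilityMeasure_map (h.measurable_jump 0).aemeasurable
  have key := integral_prod_cexp_increments h Δ n (Pi.single j u)
  rw [charFun_apply_real, integral_map (measurable_increments h Δ n j).aemeasurable (by fun_prop)]
  convert! key using 1
  · congr 1 with ω
    rw [Finset.prod_eq_single j]
    · simp
    · intro i _ hi
      simp [Pi.single_eq_of_ne hi]
    · simp
  · rw [Finset.prod_eq_single j]
    · simp
    · intro i _ hi
      simp [Pi.single_eq_of_ne hi]
    · simp

/-- The joint characteristic function is the product of the marginal ones, which characterizes
independence. -/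
lemma iIndepFun_increments (h : IsCompoundPoissonPair N X 1 f P) (Δ : ℝ≥0) (n : ℕ) :
    iIndepFun (fun (j : Fin n) ω => increments (compoundProcess N X) Δ n ω j) P := by
  rw [iIndepFun_iff_charFun_pi fun j => (measurable_increments h Δ n j).aemeasurable]
  intro u
  simp only [charFun_increments h]
  rw [← integral_prod_cexp_increments h Δ n (fun j => u j), charFun_apply, integral_map]
  · congr 1 with ω
    rw [← Complex.exp_sum, ← Finset.sum_mul]
    congr 2
    simp [PiLp.inner_apply]
  · have := measurable_increments h Δ n
    exact (WithLp.measurable_toLp 2 _).comp (measurable_pi_lambda _ this) |>.aemeasurable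
  · fun_prop

lemma charFun_compoundProcess (h : IsCompoundPoissonPair N X 1 f P) (Δ : ℝ≥0) (u : ℝ) :
    charFun (P.map (compoundProcess N X Δ)) u
      = Complex.exp (Δ * (charFun (lawOfDensity f) u - 1)) := by
  rw [← charFun_increments h Δ 1 0]
  congr 1
  refine Measure.map_congr ?_
  filter_upwards [h.poisson.zero] with ω hω
  simp [increments, compoundProcess, hω]

lemma lintegral_sq_sum_sub {A : ℕ → Ω → ℝ} (hA : ∀ i, MemLp (A i) 2 P) (hind : iIndepFun A P)
    {μ s : ℝ} (hμ : ∀ i, ∫ ω, A i ω ∂P = μ) (hs : ∀ i, Var[A i; P] = s) (k : ℕ) (c : ℝ) :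
    ∫⁻ ω, ENNReal.ofReal ((∑ i ∈ Finset.range k, A i ω - c) ^ 2) ∂P
      = ENNReal.ofReal (s * k + (k * μ - c) ^ 2) := by
  have hS : MemLp (fun ω => ∑ i ∈ Finset.range k, A i ω) 2 P :=
    memLp_finsetSum _ fun i _ => hA i
  have hSc : MemLp (fun ω => ∑ i ∈ Finset.range k, A i ω - c) 2 P := hS.sub (memLp_const c)
  rw [← ofReal_integral_eq_lintegral_ofReal hSc.integrable_sq (ae_of_all _ fun ω => sq_nonneg _)]
  congr 1
  have hvar : Var[fun ω => ∑ i ∈ Finset.range k, A i ω - c; P] = s * k := by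
    rw [variance_sub_const hS.aestronglyMeasurable]
    have := IndepFun.variance_sum (s := Finset.range k) (fun i _ => hA i)
      (fun i _ j _ hij => hind.indepFun hij)
    simp only [hs] at this
    rw [show (fun ω => ∑ i ∈ Finset.range k, A i ω) = ∑ i ∈ Finset.range k, A i by
      ext; simp, this]
    simp [mul_comm]
  have hmean : ∫ ω, (∑ i ∈ Finset.range k, A i ω - c) ∂P = k * μ - c := by
    rw [integral_sub (hS.integrable (by norm_num)) (integrable_const _),
      integral_finsetSum _ fun i _ => (hA i).integrable (by norm_num)]
    simp [hμ]
  have := variance_eq_sub hSc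
  rw [hvar, hmean] at this
  simp only [Pi.pow_apply] at this
  linarith

/-- Chebyshev's inequality for the total jump size up to time `t`. -/
lemma measure_sum_abs_jumps_ge_le (h : IsCompoundPoissonPair N X 1 f P)
    (hf2 : MemLp id 2 (lawOfDensity f)) {t : ℝ≥0} (ht : 0 < t) :
    P {ω | t * (∫ x, |x| ∂(lawOfDensity f) + 1) ≤ ∑ i ∈ Finset.range (N t ω), |X i ω|}
      ≤ ENNReal.ofReal ((∫ x, x ^ 2 ∂(lawOfDensity f)) / t) := by
  have hlawprob : IsProbabilityMeasure (lawOfDensity f) := by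
    rw [← h.law_jump 0]
    exact Measure.isProbabilityMeasure_map (h.measurable_jump 0).aemeasurable
  set ν := lawOfDensity f
  set μ := ∫ x, |x| ∂ν
  set q := ∫ x, x ^ 2 ∂ν
  have habs : MemLp (fun x : ℝ => |x|) 2 ν := hf2.abs
  have hvarν : Var[fun x : ℝ => |x|; ν] = q - μ ^ 2 := by
    rw [variance_eq_sub habs]
    simp [q, μ]
  have hA : ∀ i, MemLp (fun ω => |X i ω|) 2 P := fun i => by
    have : MemLp (fun x : ℝ => |x|) 2 (P.map (X i)) := by rw [h.law_jump i]; exact habs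
    exact this.comp_of_map (h.measurable_jump i).aemeasurable
  have hind : iIndepFun (fun i ω => |X i ω|) P :=
    h.indep_jumps.comp (fun _ x => |x|) (fun _ => by fun_prop)
  have hμ : ∀ i, ∫ ω, |X i ω| ∂P = μ := fun i => by
    rw [← integral_map (f := fun x : ℝ => |x|) (h.measurable_jump i).aemeasurable (by fun_prop),
      h.law_jump i]
  have hs : ∀ i, Var[fun ω => |X i ω|; P] = q - μ ^ 2 := fun i => by
    rw [← hvarν, show ν = P.map (X i) from (h.law_jump i).symm,
      variance_map (by fun_prop) (h.measurable_jump i).aemeasurable]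
    rfl
  have hs0 : 0 ≤ q - μ ^ 2 := hvarν ▸ variance_nonneg _ _
  have hXN : IndepFun (fun ω j => X j ω) (N t) P :=
    h.indep.comp measurable_id (measurable_pi_apply t)
  have hXm : Measurable fun ω j => X j ω := measurable_pi_lambda _ h.measurable_jump
  let G : (ℕ → ℝ) × ℕ → ℝ≥0∞ := fun p =>
    ENNReal.ofReal ((∑ i ∈ Finset.range p.2, |p.1 i| - t * μ) ^ 2)
  have hG : Measurable G := by
    have : Measurable fun p : (ℕ → ℝ) × ℕ => ∑ i ∈ Finset.range p.2, |p.1 i| :=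
      measurable_from_prod_countable_left fun k => by
        dsimp only
        fun_prop
    fun_prop
  -- Given `N t = k`, the second moment about `tμ` is `(q - μ²) k + μ² (k - t)²`, with Poisson
  -- average `t q`. The threshold lies `t` above the mean `tμ`, so Chebyshev gives `t q / t²`.
  have hsecond : ∫⁻ ω, G (fun j => X j ω, N t ω) ∂P = ENNReal.ofReal (t * q) := by
    rw [lintegral_comp_of_indepFun hXm (h.poisson.measurable t) hXN hG]
    simp only [G, lintegral_sq_sum_sub hA hind hμ hs]
    have hlaw : P.map (N t) = poissonMeasure t := by
      have := h.poisson.law_increments 0 t zero_le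
      rw [one_mul, tsub_zero] at this
      rw [← this]
      refine Measure.map_congr ?_
      filter_upwards [h.poisson.zero] with ω hω
      simp [hω]
    have := lintegral_affine_add_sq_poissonMeasure t (c := μ) hs0
    rw [← hlaw, lintegral_map (by fun_prop) (h.poisson.measurable t)] at this
    rw [show (t : ℝ) * q = t * (q - μ ^ 2 + μ ^ 2) by ring, ← this]
    congr 1 with ω
    congr 1
    ring
  have hsub : {ω | t * (μ + 1) ≤ ∑ i ∈ Finset.range (N t ω), |X i ω|}
      ⊆ {ω | ENNReal.ofReal ((t : ℝ) ^ 2) ≤ G (fun j => X j ω, N t ω)} := by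
    intro ω hω
    simp only [Set.mem_ofPred_eq] at hω ⊢
    refine ENNReal.ofReal_le_ofReal (pow_le_pow_left₀ t.coe_nonneg ?_ 2)
    dsimp only
    linarith
  have ht' : (0 : ℝ) < t := ht
  calc _ ≤ _ := measure_mono hsub
    _ ≤ _ := meas_ge_le_lintegral_div
      (hG.comp (hXm.prodMk (h.poisson.measurable t))).aemeasurable 
        (by simpa using ht.ne') (by simp)
    _ = _ := by
      rw [Function.comp_def, hsecond, ← ENNReal.ofReal_div_of_pos (by positivity)]
      congr 1
      field_simp

end CompoundPoisson

/-! ### Deterministic analysis of the empirical characteristic function and its logarithm. -/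

section Ecf

variable {n : ℕ} (y : Fin n → ℝ)

lemma hasDerivAt_ecf (u : ℝ) : HasDerivAt (ecf y) (ecfDeriv y u) u := by
  unfold ecf ecfDeriv
  refine HasDerivAt.const_mul _ (HasDerivAt.fun_sum fun j _ => ?_)
  have h1 : HasDerivAt (fun u : ℝ => Complex.I * u * y j) (Complex.I * y j) u := by
    simpa using ((hasDerivAt_id u).ofReal_comp.const_mul Complex.I).mul_const (y j : ℂ)
  simpa [mul_comm] using h1.cexp

@[fun_prop]
lemma continuous_ecf : Continuous (ecf y) := by
  unfold ecf
  fun_prop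

@[fun_prop]
lemma continuous_ecfDeriv : Continuous (ecfDeriv y) := by
  unfold ecfDeriv
  fun_prop

lemma ecf_zero (hn : n ≠ 0) : ecf y 0 = 1 := by
  simp [ecf, hn]

lemma ecf_neg (u : ℝ) : ecf y (-u) = (starRingEnd ℂ) (ecf y u) := by
  simp [ecf, ← Complex.exp_conj]

lemma norm_ecfDeriv_le (u : ℝ) : ‖ecfDeriv y u‖ ≤ (n : ℝ)⁻¹ * ∑ j, |y j| := by
  rw [ecfDeriv, norm_mul, norm_inv, Complex.norm_natCast]
  gcongr
  refine (norm_sum_le _ _).trans_eq (Finset.sum_congr rfl fun j _ => ?_)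
  rw [mul_assoc Complex.I (u : ℂ), mul_comm Complex.I (_ * _), norm_mul, ← Complex.ofReal_mul,
    Complex.norm_exp_ofReal_mul_I]
  simp

lemma norm_ecf_sub_le (u v : ℝ) :
    ‖ecf y u - ecf y v‖ ≤ ((n : ℝ)⁻¹ * ∑ j, |y j|) * |u - v| :=
  Convex.norm_image_sub_le_of_norm_hasDerivWithin_le
    (fun x _ => (hasDerivAt_ecf y x).hasDerivWithinAt) (fun x _ => norm_ecfDeriv_le y x)
    convex_univ (Set.mem_univ v) (Set.mem_univ u)

lemma norm_phiTilde_le (Δ u : ℝ) : ‖phiTilde Δ y u‖ ≤ 4 := by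
  unfold phiTilde
  split_ifs with h
  · exact h.2
  · simp

variable {y}

/-- As long as the empirical characteristic function stays within half the modulus of
`exp (Δ (φ - 1))`, its distinguished logarithm is obtained from the principal branch. -/
lemma ecfLog_eq {φ φ' : ℝ → ℂ} (hφ : ∀ v, HasDerivAt φ (φ' v) v) (hφ0 : φ 0 = 1) (hn : n ≠ 0)
    {Δ u : ℝ} (hgood : ∀ v ∈ Set.uIcc 0 u,
      ‖ecf y v - Complex.exp (Δ * (φ v - 1))‖ ≤ ‖Complex.exp (Δ * (φ v - 1))‖ / 2) :
    IntervalIntegrable (fun z => ecfDeriv y z / ecf y z) volume 0 u ∧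
      ecfLog y u = Complex.log (ecf y u / Complex.exp (Δ * (φ u - 1))) + Δ * (φ u - 1) := by
  have hne : ∀ v ∈ Set.uIcc 0 u, ecf y v ≠ 0 := by
    intro v hv h0
    have h1 := hgood v hv
    rw [h0, zero_sub, norm_neg] at h1
    linarith [norm_pos_iff.2 (Complex.exp_ne_zero (Δ * (φ v - 1)))]
  have hslit : ∀ v ∈ Set.uIcc 0 u,
      ecf y v / Complex.exp (Δ * (φ v - 1)) ∈ Complex.slitPlane := by
    intro v hv
    have hpos := norm_pos_iff.2 (Complex.exp_ne_zero (Δ * (φ v - 1)))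
    have h1 : ‖ecf y v / Complex.exp (Δ * (φ v - 1)) - 1‖ < 1 := by
      rw [div_sub_one (Complex.exp_ne_zero _), norm_div, div_lt_one hpos]
      linarith [hgood v hv]
    simpa using Complex.mem_slitPlane_of_norm_lt_one h1
  have hint : IntervalIntegrable (fun z => ecfDeriv y z / ecf y z) volume 0 u :=
    ContinuousOn.intervalIntegrable
      (((continuous_ecfDeriv y).continuousOn).div (continuous_ecf y).continuousOn hne)
  refine ⟨hint, ?_⟩
  -- The derivative of `Δ (φ - 1)` cancels the contribution of the denominator, leaving the
  -- logarithmic derivative of `ecf y`. The antiderivative vanishes at `0`, so no multiple of `2πi`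
  -- appears.
  have hderiv : ∀ v ∈ Set.uIcc 0 u, HasDerivAt (fun v =>
      Complex.log (ecf y v / Complex.exp (Δ * (φ v - 1))) + Δ * (φ v - 1))
      (ecfDeriv y v / ecf y v) v := by
    intro v hv
    have hE : HasDerivAt (fun v => (Δ : ℂ) * (φ v - 1)) (Δ * φ' v) v :=
      ((hφ v).sub_const 1).const_mul _
    have := (((hasDerivAt_ecf y v).div hE.cexp (Complex.exp_ne_zero _)).clog_real (hslit v hv)).add
      hE
    convert! this using 1
    have := hne v hv
    have := Complex.exp_ne_zero (Δ * (φ v - 1))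
    simp only [Pi.div_apply]
    field_simp
    ring
  rw [ecfLog, intervalIntegral.integral_eq_sub_of_hasDerivAt hderiv hint, ecf_zero y hn, hφ0]
  simp

/-- The factor `3/2` is that of `|log (1 + z)| ≤ 3/2 |z|` for `|z| ≤ 1/2`. Truncation cannot hurt:
where `|phiHat| > 4`, its error exceeds `3`, while replacing it by `0` costs at most `|φ| ≤ 1`. -/
lemma norm_phiTilde_sub_le {φ φ' : ℝ → ℂ} (hφ : ∀ v, HasDerivAt φ (φ' v) v) (hφ0 : φ 0 = 1)
    (hφ1 : ∀ v, ‖φ v‖ ≤ 1) (hn : n ≠ 0) {Δ u : ℝ} (hΔ : 0 < Δ) (hgood : ∀ v ∈ Set.uIcc 0 u,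
      ‖ecf y v - Complex.exp (Δ * (φ v - 1))‖ ≤ ‖Complex.exp (Δ * (φ v - 1))‖ / 2) :
    ‖phiTilde Δ y u - φ u‖
      ≤ 3 / 2 * Δ⁻¹ * (‖ecf y u - Complex.exp (Δ * (φ u - 1))‖ /
        ‖Complex.exp (Δ * (φ u - 1))‖) := by
  obtain ⟨hint, hlog⟩ := ecfLog_eq hφ hφ0 hn hgood
  have hpos := norm_pos_iff.2 (Complex.exp_ne_zero (Δ * (φ u - 1)))
  have hr : ‖ecf y u / Complex.exp (Δ * (φ u - 1)) - 1‖ =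
      ‖ecf y u - Complex.exp (Δ * (φ u - 1))‖ / ‖Complex.exp (Δ * (φ u - 1))‖ := by
    rw [div_sub_one (Complex.exp_ne_zero _), norm_div]
  have hr2 : ‖ecf y u / Complex.exp (Δ * (φ u - 1)) - 1‖ ≤ 1 / 2 := by
    rw [hr, div_le_iff₀ hpos]
    linarith [hgood u Set.right_mem_uIcc]
  have hhat : ‖phiHat Δ y u - φ u‖ ≤ 3 / 2 * Δ⁻¹ *
      (‖ecf y u - Complex.exp (Δ * (φ u - 1))‖ / ‖Complex.exp (Δ * (φ u - 1))‖) := by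
    have hΔ' : (Δ : ℂ) ≠ 0 := by exact_mod_cast hΔ.ne'
    have e : phiHat Δ y u - φ u =
        (Δ : ℂ)⁻¹ * Complex.log (ecf y u / Complex.exp (Δ * (φ u - 1))) := by
      rw [phiHat, hlog]
      field_simp
      ring
    rw [e, norm_mul, norm_inv, Complex.norm_real, Real.norm_of_nonneg hΔ.le, ← hr]
    have := Complex.norm_log_one_add_half_le_self hr2
    rw [add_sub_cancel] at this
    calc _ ≤ Δ⁻¹ * (3 / 2 * ‖ecf y u / Complex.exp (Δ * (φ u - 1)) - 1‖) := by gcongr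
      _ = _ := by ring
  unfold phiTilde
  split_ifs with h
  · exact hhat
  · have h4 : 4 < ‖phiHat Δ y u‖ := by
      by_contra hle
      exact h ⟨hint, not_lt.1 hle⟩
    refine le_trans ?_ hhat
    rw [zero_sub, norm_neg]
    have := norm_sub_norm_le (phiHat Δ y u) (φ u)
    linarith [hφ1 u]

/-- A Lipschitz function that vanishes at `0` and is small on a fine grid is small. -/
lemma norm_le_of_grid {D : ℝ → ℂ} (hsymm : ∀ v, ‖D (-v)‖ = ‖D v‖) (h0 : D 0 = 0) {K h ε : ℝ}
    (hK0 : 0 ≤ K) (hK : ∀ u v, ‖D u - D v‖ ≤ K * |u - v|) (hh : 0 < h) (hKh : K * h ≤ ε) {u : ℝ}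
    (hgrid : ∀ k : ℕ, (k + 1) * h ≤ |u| → ‖D ((k + 1) * h)‖ ≤ ε) {v : ℝ} (hv : |v| ≤ |u|) :
    ‖D v‖ ≤ 2 * ε := by
  have hε : 0 ≤ ε := le_trans (by positivity) hKh
  have habs : ‖D v‖ = ‖D |v|‖ := by
    rcases abs_choice v with h | h <;> simp [h, hsymm]
  rw [habs]
  set w := |v|
  have hw : 0 ≤ w / h := by positivity
  -- The grid point `k h` is the last one at or below `w`. The case `k = 0` is covered by `D 0 = 0`,
  -- so the grid hypothesis may start at `h`.
  set k := ⌊w / h⌋₊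
  have hk1 : k * h ≤ w := by
    have := Nat.floor_le hw
    rwa [le_div_iff₀ hh] at this
  have hk2 : w ≤ k * h + h := by
    have := (Nat.lt_floor_add_one (w / h)).le
    rw [div_le_iff₀ hh] at this
    linarith
  have hDk : ‖D (k * h)‖ ≤ ε := by
    cases hk : k with
    | zero => simpa [h0] using hε
    | succ j =>
      push_cast
      refine hgrid j (le_trans ?_ hv)
      rw [hk] at hk1
      exact_mod_cast hk1
  have hd : ‖D w - D (k * h)‖ ≤ ε := by
    refine (hK _ _).trans (le_trans ?_ hKh)
    gcongr
    rw [abs_of_nonneg (by linarith)]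
    linarith
  have := norm_le_norm_add_norm_sub (D (k * h)) (D w)
  rw [norm_sub_rev] at this
  linarith

end Ecf

/-! ### Measurability of the truncated estimator in the frequency. -/

section Measurability

lemma measurable_indicator_uIoc {g : ℝ → ℂ} (hg : Measurable g) :
    Measurable fun p : ℝ × ℝ => (Set.uIoc 0 p.1).indicator g p.2 := by
  have hs : MeasurableSet {p : ℝ × ℝ | p.2 ∈ Set.uIoc 0 p.1} := by
    simp only [Set.uIoc, Set.mem_Ioc]
    exact (measurableSet_lt (measurable_const.min measurable_fst) measurable_snd).inter
      (measurableSet_le measurable_snd (measurable_const.max measurable_fst))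
  exact (hg.comp measurable_snd).indicator hs

lemma measurableSet_intervalIntegrable {g : ℝ → ℂ} (hg : Measurable g) :
    MeasurableSet {u | IntervalIntegrable g volume 0 u} := by
  have := measurableSet_integrable (μ := (volume : Measure ℝ))
    (f := fun u z => (Set.uIoc 0 u).indicator g z) (measurable_indicator_uIoc hg).stronglyMeasurable
  simpa only [intervalIntegrable_iff, integrable_indicator_iff measurableSet_uIoc] using this

lemma measurable_intervalIntegral {g : ℝ → ℂ} (hg : Measurable g) :
    Measurable fun u => ∫ z in (0 : ℝ)..u, g z := by
  have := ((measurable_indicator_uIoc hg).stronglyMeasurable.integral_prod_right'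
    (ν := (volume : Measure ℝ))).measurable
  simp only [integral_indicator measurableSet_uIoc] at this
  simp only [intervalIntegral.intervalIntegral_eq_integral_uIoc]
  have hsign : Measurable fun u : ℝ => if 0 ≤ u then (1 : ℝ) else -1 :=
    Measurable.ite measurableSet_Ici measurable_const measurable_const
  exact hsign.smul this

lemma measurable_phiTilde {n : ℕ} (Δ : ℝ) (y : Fin n → ℝ) : Measurable (phiTilde Δ y) := by
  have hg : Measurable fun z => ecfDeriv y z / ecf y z :=
    (continuous_ecfDeriv y).measurable.div (continuous_ecf y).measurable
  have hhat : Measurable (phiHat Δ y) :=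
    ((measurable_intervalIntegral hg).const_mul _).const_add _
  exact Measurable.ite ((measurableSet_intervalIntegrable hg).inter
    (measurableSet_le hhat.norm measurable_const)) hhat measurable_const

end Measurability

/-! ### Hoeffding's inequality and variance for bounded means. -/

section IidMeans

variable {Ω : Type*} [MeasurableSpace Ω] {P : Measure Ω} [IsProbabilityMeasure P] {n : ℕ}
  {Y : Fin n → Ω → ℝ} {g : ℝ → ℝ} {c : ℝ}

/-- Hoeffding's inequality: a centred variable with values in an interval of length `2` is
sub-Gaussian with parameter `1`. -/
lemma measureReal_mean_sub_ge_le (hY : ∀ j, Measurable (Y j)) (hind : iIndepFun Y P)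
    (hg : Measurable g) (hg1 : ∀ x, |g x| ≤ 1) (hc : ∀ j, ∫ ω, g (Y j ω) ∂P = c) (hn : n ≠ 0)
    {ε : ℝ} (hε : 0 ≤ ε) :
    P.real {ω | ε ≤ (n : ℝ)⁻¹ * ∑ j, g (Y j ω) - c} ≤ Real.exp (-(n * ε ^ 2 / 2)) := by
  have hn' : (0 : ℝ) < n := by exact_mod_cast Nat.pos_of_ne_zero hn
  have hsub : ∀ j ∈ Finset.univ, HasSubgaussianMGF (fun ω => g (Y j ω) - c)
      ((‖(1 : ℝ) - (-1)‖₊ / 2) ^ 2) P := by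
    intro j _
    have := hasSubgaussianMGF_of_mem_Icc (μ := P) (X := fun ω => g (Y j ω)) (a := -1) (b := 1)
      (hg.comp (hY j)).aemeasurable (ae_of_all _ fun ω => abs_le.1 (hg1 _))
    rwa [hc j] at this
  have hind' : iIndepFun (fun j ω => g (Y j ω) - c) P :=
    hind.comp (fun _ x => g x - c) fun _ => hg.sub_const c
  have key := HasSubgaussianMGF.measure_sum_ge_le_of_iIndepFun hind' hsub
    (ε := n * ε) (by positivity)
  have hcoef : ((‖(1 : ℝ) - (-1)‖₊ / 2) ^ 2 : ℝ≥0) = 1 := by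
    ext
    simp
    norm_num
  simp only [hcoef, Finset.sum_const, Finset.card_univ, Fintype.card_fin] at key
  have hset : {ω | ε ≤ (n : ℝ)⁻¹ * ∑ j, g (Y j ω) - c}
      = {ω | n * ε ≤ ∑ j, (g (Y j ω) - c)} := by
    ext ω
    simp only [Set.mem_ofPred_eq, Finset.sum_sub_distrib, Finset.sum_const, Finset.card_univ,
      Fintype.card_fin, nsmul_eq_mul]
    rw [← mul_le_mul_iff_right₀ hn', mul_sub, mul_inv_cancel_left₀ hn'.ne']
  rw [hset]
  refine key.trans_eq ?_
  congr 1
  simp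
  field_simp

lemma measureReal_abs_mean_sub_ge_le (hY : ∀ j, Measurable (Y j)) (hind : iIndepFun Y P)
    (hg : Measurable g) (hg1 : ∀ x, |g x| ≤ 1) (hc : ∀ j, ∫ ω, g (Y j ω) ∂P = c) (hn : n ≠ 0)
    {ε : ℝ} (hε : 0 ≤ ε) :
    P.real {ω | ε ≤ |(n : ℝ)⁻¹ * ∑ j, g (Y j ω) - c|} ≤ 2 * Real.exp (-(n * ε ^ 2 / 2)) := by
  have h1 := measureReal_mean_sub_ge_le hY hind hg hg1 hc hn hε
  have h2 := measureReal_mean_sub_ge_le (g := fun x => -g x) (c := -c) hY hind hg.neg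
    (by simpa using hg1) (by simpa [integral_neg] using hc) hn hε
  have hset : {ω | ε ≤ |(n : ℝ)⁻¹ * ∑ j, g (Y j ω) - c|}
      ⊆ {ω | ε ≤ (n : ℝ)⁻¹ * ∑ j, g (Y j ω) - c} ∪
        {ω | ε ≤ (n : ℝ)⁻¹ * ∑ j, -g (Y j ω) - -c} := by
    intro ω hω
    simp only [Set.mem_ofPred_eq, Set.mem_union, Finset.sum_neg_distrib] at hω ⊢
    rcases le_abs.1 hω with h | h
    · exact Or.inl h
    · exact Or.inr (by linarith)
  calc _ ≤ _ := measureReal_mono hset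
    _ ≤ _ := measureReal_union_le _ _
    _ ≤ _ := by linarith

lemma memLp_mean (hY : ∀ j, Measurable (Y j)) (hg : Measurable g) (hg1 : ∀ x, |g x| ≤ 1) :
    MemLp (fun ω => (n : ℝ)⁻¹ * ∑ j, g (Y j ω)) 2 P := by
  have hL : ∀ j, MemLp (fun ω => g (Y j ω)) 2 P := fun j =>
    MemLp.of_bound (hg.comp (hY j)).aestronglyMeasurable 1 (ae_of_all _ fun ω => hg1 _)
  have hS : MemLp (fun ω => ∑ j, g (Y j ω)) 2 P := memLp_finsetSum _ fun j _ => hL j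
  exact hS.const_mul _

lemma integrable_sq_mean_sub (hY : ∀ j, Measurable (Y j)) (hg : Measurable g)
    (hg1 : ∀ x, |g x| ≤ 1) (c : ℝ) :
    Integrable (fun ω => ((n : ℝ)⁻¹ * ∑ j, g (Y j ω) - c) ^ 2) P :=
  ((memLp_mean hY hg hg1).sub (memLp_const c)).integrable_sq

lemma integral_sq_mean_sub (hY : ∀ j, Measurable (Y j)) (hind : iIndepFun Y P)
    (hg : Measurable g) (hg1 : ∀ x, |g x| ≤ 1) (hc : ∀ j, ∫ ω, g (Y j ω) ∂P = c) {q : ℝ}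
    (hq : ∀ j, ∫ ω, g (Y j ω) ^ 2 ∂P = q) (hn : n ≠ 0) :
    ∫ ω, ((n : ℝ)⁻¹ * ∑ j, g (Y j ω) - c) ^ 2 ∂P = (q - c ^ 2) / n := by
  have hn' : (0 : ℝ) < n := by exact_mod_cast Nat.pos_of_ne_zero hn
  have hL : ∀ j, MemLp (fun ω => g (Y j ω)) 2 P := fun j =>
    MemLp.of_bound (hg.comp (hY j)).aestronglyMeasurable 1 (ae_of_all _ fun ω => hg1 _)
  have hmean : ∫ ω, (n : ℝ)⁻¹ * ∑ j, g (Y j ω) ∂P = c := by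
    rw [integral_const_mul, integral_finsetSum _ fun j _ => (hL j).integrable (by norm_num)]
    simp [hc, hn]
  have hvar : Var[fun ω => (n : ℝ)⁻¹ * ∑ j, g (Y j ω); P] = (q - c ^ 2) / n := by
    rw [variance_const_mul]
    have h1 := IndepFun.variance_sum (s := Finset.univ) (fun j _ => hL j)
      (fun i _ j _ hij => (hind.indepFun hij).comp hg hg)
    rw [show (fun ω => ∑ j, g (Y j ω)) = ∑ j, fun ω => g (Y j ω) by ext; simp, h1]
    have h2 : ∀ j, Var[fun ω => g (Y j ω); P] = q - c ^ 2 := fun j => by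
      rw [variance_eq_sub (hL j), hc j, ← hq j]
      rfl
    simp only [h2, Finset.sum_const, Finset.card_univ, Fintype.card_fin, nsmul_eq_mul]
    field_simp
  rw [← hvar, variance_eq_integral (memLp_mean hY hg hg1).aemeasurable, hmean]

end IidMeans

/-! ### Fluctuations of the empirical characteristic function. -/

section EcfFluctuation

variable {Ω : Type*} [MeasurableSpace Ω] {P : Measure Ω} [IsProbabilityMeasure P] {n : ℕ}
  {Y : Ω → Fin n → ℝ} {ψ : ℝ → ℂ}

lemma ecf_re (y : Fin n → ℝ) (u : ℝ) : (ecf y u).re = (n : ℝ)⁻¹ * ∑ j, Real.cos (u * y j) := by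
  rw [ecf, ← Complex.ofReal_natCast, ← Complex.ofReal_inv, Complex.re_ofReal_mul, Complex.re_sum]
  congr 2 with j
  rw [mul_assoc, mul_comm Complex.I, ← Complex.ofReal_mul, Complex.exp_ofReal_mul_I_re]

lemma ecf_im (y : Fin n → ℝ) (u : ℝ) : (ecf y u).im = (n : ℝ)⁻¹ * ∑ j, Real.sin (u * y j) := by
  rw [ecf, ← Complex.ofReal_natCast, ← Complex.ofReal_inv, Complex.im_ofReal_mul, Complex.im_sum]
  congr 2 with j
  rw [mul_assoc, mul_comm Complex.I, ← Complex.ofReal_mul, Complex.exp_ofReal_mul_I_im]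

lemma integral_cos_eq_re_charFun {Z : Ω → ℝ} (hZ : Measurable Z) (u : ℝ) :
    ∫ ω, Real.cos (u * Z ω) ∂P = (charFun (P.map Z) u).re := by
  rw [charFun_apply_real, integral_map hZ.aemeasurable (by fun_prop), ← RCLike.re_eq_complex_re,
    ← integral_re]
  · congr 1 with ω
    rw [RCLike.re_eq_complex_re, ← Complex.ofReal_mul, Complex.exp_ofReal_mul_I_re]
  · refine Integrable.of_bound (by fun_prop) 1 (ae_of_all _ fun x => ?_)
    rw [← Complex.ofReal_mul, Complex.norm_exp_ofReal_mul_I]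

lemma integral_sin_eq_im_charFun {Z : Ω → ℝ} (hZ : Measurable Z) (u : ℝ) :
    ∫ ω, Real.sin (u * Z ω) ∂P = (charFun (P.map Z) u).im := by
  rw [charFun_apply_real, integral_map hZ.aemeasurable (by fun_prop), ← RCLike.im_eq_complex_im,
    ← integral_im]
  · congr 1 with ω
    rw [RCLike.im_eq_complex_im, ← Complex.ofReal_mul, Complex.exp_ofReal_mul_I_im]
  · refine Integrable.of_bound (by fun_prop) 1 (ae_of_all _ fun x => ?_)
    rw [← Complex.ofReal_mul, Complex.norm_exp_ofReal_mul_I]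

/-- Hoeffding's inequality for the empirical characteristic function. -/
lemma measure_norm_ecf_sub_gt_le (hY : ∀ j, Measurable fun ω => Y ω j)
    (hind : iIndepFun (fun j ω => Y ω j) P) (hψ : ∀ j u, charFun (P.map fun ω => Y ω j) u = ψ u)
    (hn : n ≠ 0) (u : ℝ) {ε : ℝ} (hε : 0 ≤ ε) :
    P {ω | ε < ‖ecf (Y ω) u - ψ u‖} ≤ ENNReal.ofReal (4 * Real.exp (-(n * ε ^ 2 / 8))) := by
  have hre := measureReal_abs_mean_sub_ge_le (g := fun x => Real.cos (u * x)) (c := (ψ u).re)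
    hY hind (by fun_prop) (fun x => Real.abs_cos_le_one _)
    (fun j => by rw [integral_cos_eq_re_charFun (hY j), hψ]) hn (ε := ε / 2) (by positivity)
  have him := measureReal_abs_mean_sub_ge_le (g := fun x => Real.sin (u * x)) (c := (ψ u).im)
    hY hind (by fun_prop) (fun x => Real.abs_sin_le_one _)
    (fun j => by rw [integral_sin_eq_im_charFun (hY j), hψ]) hn (ε := ε / 2) (by positivity)
  -- Real or imaginary part must deviate by `ε / 2`; this turns `2` into `8` in the exponent, and
  -- two two-sided bounds give the factor `4`.
  have hset : {ω | ε < ‖ecf (Y ω) u - ψ u‖} ⊆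
      {ω | ε / 2 ≤ |(n : ℝ)⁻¹ * ∑ j, Real.cos (u * Y ω j) - (ψ u).re|} ∪
      {ω | ε / 2 ≤ |(n : ℝ)⁻¹ * ∑ j, Real.sin (u * Y ω j) - (ψ u).im|} := by
    intro ω hω
    simp only [Set.mem_ofPred_eq, Set.mem_union] at hω ⊢
    have h1 := Complex.norm_le_abs_re_add_abs_im (ecf (Y ω) u - ψ u)
    rw [Complex.sub_re, Complex.sub_im, ecf_re, ecf_im] at h1
    by_contra! hcon
    linarith [hcon.1, hcon.2]
  rw [← ENNReal.ofReal_toReal (measure_ne_top P {ω | ε < ‖ecf (Y ω) u - ψ u‖})]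
  refine ENNReal.ofReal_le_ofReal ?_
  calc _ ≤ _ := measureReal_mono hset
    _ ≤ _ := measureReal_union_le _ _
    _ ≤ _ := add_le_add hre him
    _ = _ := by
      rw [show (n : ℝ) * (ε / 2) ^ 2 / 2 = n * ε ^ 2 / 8 by ring]
      ring

/-- The variance of the empirical characteristic function. -/
lemma lintegral_norm_ecf_sub_sq (hY : ∀ j, Measurable fun ω => Y ω j)
    (hind : iIndepFun (fun j ω => Y ω j) P) (hψ : ∀ j u, charFun (P.map fun ω => Y ω j) u = ψ u)
    (hn : n ≠ 0) (u : ℝ) :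
    ∫⁻ ω, ENNReal.ofReal (‖ecf (Y ω) u - ψ u‖ ^ 2) ∂P
      = ENNReal.ofReal ((1 - ‖ψ u‖ ^ 2) / n) := by
  have j₀ : Fin n := ⟨0, Nat.pos_of_ne_zero hn⟩
  have hcosint : ∀ j, Integrable (fun ω => Real.cos (u * Y ω j) ^ 2) P := fun j =>
    Integrable.of_bound ((Real.measurable_cos.comp ((hY j).const_mul u)).pow_const
      2).aestronglyMeasurable 1 (ae_of_all _ fun ω => by
        rw [Real.norm_of_nonneg (sq_nonneg _)]
        exact Real.cos_sq_le_one _)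
  have hsq : ∀ j, ∫ ω, Real.cos (u * Y ω j) ^ 2 ∂P = ∫ ω, Real.cos (u * Y ω j₀) ^ 2 ∂P := by
    have hmap : ∀ j, P.map (fun ω => Y ω j) = P.map (fun ω => Y ω j₀) := fun j => by
      have := Measure.isProbabilityMeasure_map (μ := P) (hY j).aemeasurable
      have := Measure.isProbabilityMeasure_map (μ := P) (hY j₀).aemeasurable
      exact Measure.ext_of_charFun (funext fun v => by rw [hψ, hψ])
    intro j
    rw [← integral_map (f := fun x => Real.cos (u * x) ^ 2) (hY j).aemeasurable (by fun_prop),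
      hmap j, integral_map (hY j₀).aemeasurable (by fun_prop)]
  -- The value of `q` is irrelevant: it cancels because `cos² + sin² = 1`.
  set q := ∫ ω, Real.cos (u * Y ω j₀) ^ 2 ∂P
  have hsin : ∀ j, ∫ ω, Real.sin (u * Y ω j) ^ 2 ∂P = 1 - q := fun j => by
    rw [← hsq j]
    simp only [Real.sin_sq]
    rw [integral_sub (integrable_const _) (hcosint j)]
    simp
  have hre := integral_sq_mean_sub (g := fun x => Real.cos (u * x)) (c := (ψ u).re)
    hY hind (by fun_prop) (fun x => Real.abs_cos_le_one _)
    (fun j => by rw [integral_cos_eq_re_charFun (hY j), hψ]) hsq hn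
  have him := integral_sq_mean_sub (g := fun x => Real.sin (u * x)) (c := (ψ u).im)
    hY hind (by fun_prop) (fun x => Real.abs_sin_le_one _)
    (fun j => by rw [integral_sin_eq_im_charFun (hY j), hψ]) hsin hn
  have hi1 := integrable_sq_mean_sub (P := P) hY (g := fun x => Real.cos (u * x)) (by fun_prop)
    (fun x => Real.abs_cos_le_one _) (ψ u).re
  have hi2 := integrable_sq_mean_sub (P := P) hY (g := fun x => Real.sin (u * x)) (by fun_prop)
    (fun x => Real.abs_sin_le_one _) (ψ u).im
  have hnorm : ∀ ω, ‖ecf (Y ω) u - ψ u‖ ^ 2 =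
      ((n : ℝ)⁻¹ * ∑ j, Real.cos (u * Y ω j) - (ψ u).re) ^ 2 +
      ((n : ℝ)⁻¹ * ∑ j, Real.sin (u * Y ω j) - (ψ u).im) ^ 2 := fun ω => by
    rw [Complex.sq_norm, Complex.normSq_apply, Complex.sub_re, Complex.sub_im, ecf_re, ecf_im]
    ring
  simp only [hnorm]
  rw [← ofReal_integral_eq_lintegral_ofReal (by exact hi1.add hi2)
      (ae_of_all _ fun ω => by positivity), integral_add hi1 hi2, hre, him]
  congr 1
  rw [Complex.sq_norm, Complex.normSq_apply]
  ring

end EcfFluctuation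

/-! ### Choice of the threshold, and the good event. -/

/-- For long observation times, the number of grid points times the probability of a large
deviation at one of them is negligible. -/
lemma exists_threshold {a L : ℝ} (ha0 : 0 < a) (ha2 : a < 2) (hL : 0 < L) :
    ∃ T₀ : ℝ, 1 < T₀ ∧ ∀ (n : ℕ) (Δ : ℝ), 0 < Δ → T₀ ≤ n * Δ → Δ ≤ 1 / 4 * Real.log (n * Δ) →
      16 * L * Δ * Real.exp (a * Δ) * Real.exp (-(n * Real.exp (-(2 * a * Δ)) / 128))
        ≤ 8 / (n * Δ) ^ 2 := by
  -- With `x = log T` and `Δ ≤ x / 4`, one has `2aΔ ≤ ax / 2`, hence `n exp (-2aΔ) ≥ exp (b x) / Δ`.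
  set b := 1 - a / 2
  have hb : 0 < b := by simp only [b]; linarith
  -- `160 x² = 5 x · 128 · (x / 4)` makes the Hoeffding exponent at least `5x`. Two of these `x` pay
  -- for `Δ exp (aΔ) ≤ exp (2x)`, one for the constant `L` in `ev2`, and two give `T⁻²`.
  have ev1 : ∀ᶠ x : ℝ in Filter.atTop, 160 * x ^ 2 ≤ Real.exp (b * x) := by
    have := (isLittleO_pow_exp_pos_mul_atTop 2 hb).def (c := 1 / 160) (by norm_num)
    filter_upwards [this] with x hx
    rw [Real.norm_of_nonneg (sq_nonneg x), Real.norm_of_nonneg (Real.exp_pos _).le] at hx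
    linarith
  have ev2 : ∀ᶠ x : ℝ in Filter.atTop, Real.exp (-x) < 8 / (16 * L) :=
    Real.tendsto_exp_neg_atTop_nhds_zero.eventually_lt_const (by positivity)
  obtain ⟨x₀, hx₀⟩ := Filter.eventually_atTop.1
    ((ev1.and ev2).and (Filter.eventually_ge_atTop (1 : ℝ)))
  refine ⟨Real.exp x₀, Real.one_lt_exp_iff.2 (by linarith [(hx₀ x₀ le_rfl).2]), ?_⟩
  intro n Δ hΔ hT hΔT
  set T : ℝ := n * Δ
  have hTpos : 0 < T := (Real.exp_pos _).trans_le hT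
  set x := Real.log T
  have hTx : T = Real.exp x := (Real.exp_log hTpos).symm
  have hx : x₀ ≤ x := (Real.le_log_iff_exp_le hTpos).2 hT
  obtain ⟨⟨h1, h2⟩, h3⟩ := hx₀ x hx
  have hrate : 5 * x ≤ n * Real.exp (-(2 * a * Δ)) / 128 := by
    have hn : (n : ℝ) = Real.exp x / Δ := by
      rw [← hTx]
      simp only [T]
      field_simp
    have e1 : Real.exp (b * x) ≤ Real.exp x * Real.exp (-(2 * a * Δ)) := by
      rw [← Real.exp_add]
      refine Real.exp_le_exp.2 ?_
      simp only [b]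
      nlinarith
    rw [hn, le_div_iff₀ (by norm_num), div_mul_eq_mul_div, le_div_iff₀ hΔ]
    nlinarith
  have hcount : Δ * Real.exp (a * Δ) ≤ Real.exp (2 * x) := by
    have e1 : Δ ≤ Real.exp x := by linarith [Real.add_one_le_exp x]
    have e2 : Real.exp (a * Δ) ≤ Real.exp x := Real.exp_le_exp.2 (by nlinarith)
    calc _ ≤ Real.exp x * Real.exp x := by gcongr
      _ = _ := by rw [← Real.exp_add]; ring_nf
  rw [hTx]
  calc 16 * L * Δ * Real.exp (a * Δ) * Real.exp (-(n * Real.exp (-(2 * a * Δ)) / 128))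
      = 16 * L * (Δ * Real.exp (a * Δ)) * Real.exp (-(n * Real.exp (-(2 * a * Δ)) / 128)) := by
        ring
    _ ≤ 16 * L * Real.exp (2 * x) * Real.exp (-(5 * x)) := by gcongr
    _ = 16 * L * Real.exp (-x) * Real.exp (-(2 * x)) := by
        rw [mul_assoc, mul_assoc _ (Real.exp (-x)), ← Real.exp_add, ← Real.exp_add]
        ring_nf
    _ ≤ 16 * L * (8 / (16 * L)) * Real.exp (-(2 * x)) := by gcongr
    _ = 8 / Real.exp x ^ 2 := by
        rw [← Real.exp_nat_mul, Real.exp_neg]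
        push_cast
        field_simp

section Law

variable {ν : Measure ℝ} {Δ : ℝ}

lemma norm_cexp_charFun (u : ℝ) :
    ‖Complex.exp (Δ * (charFun ν u - 1))‖ = Real.exp (-(Δ * (1 - (charFun ν u).re))) := by
  rw [Complex.norm_exp, Complex.re_ofReal_mul]
  simp only [Complex.sub_re, Complex.one_re]
  ring_nf

variable [IsProbabilityMeasure ν]

/-- `1 - e^{-s} ≤ s` with `s = 2Δ (1 - Re φ) ≤ 4Δ`. This factor `Δ` in the variance offsets one of
the two factors `1/Δ` in the squared error, which gives the rate `1/(nΔ)`. -/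
lemma one_sub_norm_cexp_charFun_sq_le (hΔ : 0 ≤ Δ) (u : ℝ) :
    1 - ‖Complex.exp (Δ * (charFun ν u - 1))‖ ^ 2 ≤ 4 * Δ := by
  rw [norm_cexp_charFun, ← Real.exp_nat_mul]
  have h1 := Real.add_one_le_exp (((2 : ℕ) : ℝ) * -(Δ * (1 - (charFun ν u).re)))
  have h2 := neg_abs_le (charFun ν u).re
  have h3 := (Complex.abs_re_le_norm (charFun ν u)).trans (norm_charFun_le_one u)
  push_cast at h1 ⊢
  nlinarith

/-- If the average absolute increment is not too large and the empirical characteristic function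
is accurate on a fine grid of `[-|u|, |u|]`, then the estimation error at `u` is linear in the
error of the empirical characteristic function. -/
lemma norm_phiTilde_sub_le_of_grid (hν : MemLp id 1 ν) {a : ℝ}
    (ha : ∀ u, 1 - (charFun ν u).re ≤ a) {n : ℕ} (hn : n ≠ 0) (hΔ : 0 < Δ) {y : Fin n → ℝ}
    (hy : (n : ℝ)⁻¹ * ∑ j, |y j| ≤ Δ * (∫ x, |x| ∂ν + 1)) {h u : ℝ}
    (hh : h = Real.exp (-(a * Δ)) / 4 / (Δ * (2 * ∫ x, |x| ∂ν + 1)))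
    (hgrid : ∀ k : ℕ, (k + 1) * h ≤ |u| → ‖ecf y ((k + 1) * h) -
      Complex.exp (Δ * (charFun ν ((k + 1) * h) - 1))‖ ≤ Real.exp (-(a * Δ)) / 4) :
    ‖phiTilde Δ y u - charFun ν u‖ ≤ 3 / 2 * Δ⁻¹ *
      (‖ecf y u - Complex.exp (Δ * (charFun ν u - 1))‖ /
        ‖Complex.exp (Δ * (charFun ν u - 1))‖) := by
  set M := ∫ x, |x| ∂ν
  have hM : 0 ≤ M := integral_nonneg fun x => abs_nonneg x
  refine norm_phiTilde_sub_le (hasDerivAt_charFun hν) (by simp) norm_charFun_le_one hn hΔ ?_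
  intro v hv
  have hvu : |v| ≤ |u| := by
    have := Set.abs_sub_left_of_mem_uIcc hv
    simpa using this
  have hlow : Real.exp (-(a * Δ)) ≤ ‖Complex.exp (Δ * (charFun ν v - 1))‖ := by
    rw [norm_cexp_charFun]
    exact Real.exp_le_exp.2 (by nlinarith [ha v])
  -- The Lipschitz constant adds `Δ (M + 1)` from the data to `Δ M` from the true characteristic
  -- function, and the mesh satisfies `K h = ε`. The conclusion `2ε = exp (-aΔ) / 2` is at most half
  -- of the modulus of the true one.
  have key := norm_le_of_grid (D := fun v => ecf y v - Complex.exp (Δ * (charFun ν v - 1)))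
    (K := Δ * (2 * M + 1)) (h := h) (ε := Real.exp (-(a * Δ)) / 4) (u := u) (v := v)
    ?_ ?_ (by positivity) ?_ (by rw [hh]; positivity) ?_ hgrid hvu
  · linarith
  · intro w
    rw [ecf_neg, charFun_neg, ← Complex.norm_conj (ecf y w - _)]
    simp [← Complex.exp_conj]
  · simp [ecf_zero y hn]
  · intro s t
    have h1 := norm_ecf_sub_le y s t
    have h2 := norm_cexp_charFun_sub_le hν hΔ.le s t
    calc _ = ‖(ecf y s - ecf y t) - (Complex.exp (Δ * (charFun ν s - 1)) -
          Complex.exp (Δ * (charFun ν t - 1)))‖ := by congr 1; ring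
      _ ≤ _ := norm_sub_le _ _
      _ ≤ Δ * (M + 1) * |s - t| + Δ * M * |s - t| := by
        gcongr
        exact h1.trans (by gcongr)
      _ = _ := by ring
  · rw [hh]
    exact (mul_div_cancel₀ _ (by positivity)).le

end Law

/-- The grid starts at `h`, so at most `w / h` of its points lie below `w`, with no additive
constant. -/
lemma tsum_ite_grid_le {h w : ℝ} (hh : 0 < h) (hw : 0 ≤ w) {p : ℝ} (hp : 0 ≤ p) :
    ∑' k : ℕ, (if ((k : ℝ) + 1) * h ≤ w then ENNReal.ofReal p else 0)
      ≤ ENNReal.ofReal (w / h * p) := by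
  rw [tsum_eq_sum (s := Finset.range ⌊w / h⌋₊)]
  · calc _ ≤ ∑ k ∈ Finset.range ⌊w / h⌋₊, ENNReal.ofReal p :=
          Finset.sum_le_sum fun k _ => by split_ifs <;> simp
      _ = ENNReal.ofReal (⌊w / h⌋₊ * p) := by
          rw [Finset.sum_const, Finset.card_range, nsmul_eq_mul,
            ENNReal.ofReal_mul (by positivity), ENNReal.ofReal_natCast]
      _ ≤ _ := by
          gcongr
          exact Nat.floor_le (by positivity)
  · intro k hk
    rw [if_neg]
    intro hle
    refine hk (Finset.mem_range.2 (Nat.lt_of_succ_le (Nat.le_floor ?_)))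
    rw [le_div_iff₀ hh]
    push_cast
    exact hle

/-- The bound `1/(2π) ≤ 1/6` brings `9` below `2`; the other two terms are integrated exactly and
that factor is then dropped from them. -/
lemma ofReal_mul_setLIntegral_le {F : ℝ → ℝ} (hF : Continuous F) {T q m : ℝ} (hT : 0 < T)
    (hF0 : ∀ u, 0 ≤ F u) (hq : 0 ≤ q) (hm : 0 ≤ m) :
    ENNReal.ofReal (2 * Real.pi)⁻¹ * ∫⁻ u in Set.Ioc (-m) m,
        ENNReal.ofReal (9 / T * F u + 25 * (q / T) + 200 / T ^ 2 * |u|)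
      ≤ ENNReal.ofReal (2 / T * (∫ u in (-m)..m, F u) + 50 * q * (m / T)
        + 200 * (m ^ 2 / T ^ 2)) := by
  have hmm : -m ≤ m := by linarith
  have hcont : Continuous fun u => 9 / T * F u + 25 * (q / T) + 200 / T ^ 2 * |u| := by fun_prop
  have hI : 0 ≤ ∫ u in (-m)..m, F u := intervalIntegral.integral_nonneg hmm fun u _ => hF0 u
  have habs : ∫ u in (-m)..m, |u| = m ^ 2 := by
    have h1 : ∫ u in (-m)..0, |u| = m ^ 2 / 2 := by
      rw [intervalIntegral.integral_congr (g := fun u => -u)]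
      · rw [intervalIntegral.integral_neg, integral_id]
        ring
      · intro u hu
        rw [Set.uIcc_of_le (by linarith)] at hu
        exact abs_of_nonpos hu.2
    have h2 : ∫ u in (0 : ℝ)..m, |u| = m ^ 2 / 2 := by
      rw [intervalIntegral.integral_congr (g := fun u => u)]
      · simp
      · intro u hu
        rw [Set.uIcc_of_le hm] at hu
        exact abs_of_nonneg hu.1
    rw [← intervalIntegral.integral_add_adjacent_intervals (b := 0)
      (continuous_abs.intervalIntegrable _ _) (continuous_abs.intervalIntegrable _ _), h1, h2]
    ring
  rw [← ofReal_integral_eq_lintegral_ofReal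
      ((hcont.intervalIntegrable (-m) m).1) (ae_of_all _ fun u => by have := hF0 u; positivity),
    ← intervalIntegral.integral_of_le hmm, ← ENNReal.ofReal_mul (by positivity)]
  refine ENNReal.ofReal_le_ofReal ?_
  have hint : ∫ u in (-m)..m, (9 / T * F u + 25 * (q / T) + 200 / T ^ 2 * |u|) =
      9 / T * (∫ u in (-m)..m, F u) + 50 * q * (m / T) + 200 * (m ^ 2 / T ^ 2) := by
    rw [intervalIntegral.integral_add (Continuous.intervalIntegrable (by fun_prop) _ _)
        (Continuous.intervalIntegrable (by fun_prop) _ _),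
      intervalIntegral.integral_add (Continuous.intervalIntegrable (by fun_prop) _ _)
        (Continuous.intervalIntegrable (by fun_prop) _ _),
      intervalIntegral.integral_const_mul (9 / T),
      intervalIntegral.integral_const_mul (200 / T ^ 2), habs,
      intervalIntegral.integral_const, smul_eq_mul]
    ring
  rw [hint]
  have hpi : (2 * Real.pi)⁻¹ ≤ 1 / 6 := by
    rw [one_div]
    exact inv_anti₀ (by norm_num) (by linarith [Real.pi_gt_three])
  have e1 : 0 ≤ 50 * q * (m / T) := by positivity
  have e2 : 0 ≤ 200 * (m ^ 2 / T ^ 2) := by positivity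
  have e3 : 0 ≤ 1 / T * (∫ u in (-m)..m, F u) := by positivity
  have e4 : 9 / T * (∫ u in (-m)..m, F u) = 9 * (1 / T * (∫ u in (-m)..m, F u)) := by ring
  have e5 : 2 / T * (∫ u in (-m)..m, F u) = 2 * (1 / T * (∫ u in (-m)..m, F u)) := by ring
  rw [e4, e5]
  calc _ ≤ 1 / 6 * (9 * (1 / T * (∫ u in (-m)..m, F u)) + 50 * q * (m / T)
        + 200 * (m ^ 2 / T ^ 2)) := by gcongr
    _ ≤ _ := by linarith

/-! ### Integrated risk. -/

section Risk

variable {Ω : Type*} [MeasurableSpace Ω] {P : Measure Ω} [IsProbabilityMeasure P]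

/-- Integrated risk bound from a decomposition of the error into a fluctuation term, a global
exceptional event and exceptional events attached to the points of a grid. -/
lemma lintegral_lintegral_error_le {E : Ω → ℝ → ℝ≥0∞} {W : Ω → ℝ → ℝ} {V : ℝ → ℝ} {S : Set Ω}
    {B : ℕ → Set Ω} (hW : Measurable (Function.uncurry W)) (hV : Measurable V)
    (hS : MeasurableSet S) (hB : ∀ k, MeasurableSet (B k)) {h : ℝ}
    (hE : ∀ᵐ ω ∂P, ∀ u, E ω u ≤ ENNReal.ofReal (V u) * ENNReal.ofReal (W ω u) +
      25 * (S.indicator 1 ω + ∑' k : ℕ, if ((k : ℝ) + 1) * h ≤ |u| then (B k).indicator 1 ω else 0))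
    {R : ℝ → ℝ} {s p : ℝ} (hh : 0 < h) (hs : 0 ≤ s) (hp : 0 ≤ p) (hV0 : ∀ u, 0 ≤ V u)
    (hR : ∀ u, ∫⁻ ω, ENNReal.ofReal (W ω u) ∂P ≤ ENNReal.ofReal (R u)) (hR0 : ∀ u, 0 ≤ R u)
    (hPS : P S ≤ ENNReal.ofReal s) (hPB : ∀ k, P (B k) ≤ ENNReal.ofReal p) (A : Set ℝ) :
    ∫⁻ ω, (∫⁻ u in A, E ω u) ∂P
      ≤ ∫⁻ u in A, ENNReal.ofReal (V u * R u + 25 * (s + |u| / h * p)) := by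
  have hmB : ∀ k : ℕ, Measurable fun q : Ω × ℝ =>
      if ((k : ℝ) + 1) * h ≤ |q.2| then (B k).indicator (1 : Ω → ℝ≥0∞) q.1 else 0 := fun k =>
    Measurable.ite (measurableSet_le measurable_const measurable_snd.abs)
      ((measurable_one.indicator (hB k)).comp measurable_fst) measurable_const
  have hmS : Measurable fun q : Ω × ℝ => S.indicator (1 : Ω → ℝ≥0∞) q.1 :=
    (measurable_one.indicator hS).comp measurable_fst
  have hmW : Measurable fun q : Ω × ℝ => ENNReal.ofReal (V q.2) * ENNReal.ofReal (W q.1 q.2) :=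
    (hV.comp measurable_snd).ennreal_ofReal.mul hW.ennreal_ofReal
  have hm : Measurable fun q : Ω × ℝ => ENNReal.ofReal (V q.2) * ENNReal.ofReal (W q.1 q.2) +
      25 * (S.indicator 1 q.1 + ∑' k : ℕ,
        if ((k : ℝ) + 1) * h ≤ |q.2| then (B k).indicator 1 q.1 else 0) :=
    hmW.add ((hmS.add (Measurable.tsum hmB)).const_mul _)
  -- The dominating function is jointly measurable, so Tonelli applies to it and no joint
  -- measurability of `E` is needed.
  calc _ ≤ ∫⁻ ω, (∫⁻ u in A, (ENNReal.ofReal (V u) * ENNReal.ofReal (W ω u) +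
        25 * (S.indicator 1 ω + ∑' k : ℕ,
          if ((k : ℝ) + 1) * h ≤ |u| then (B k).indicator 1 ω else 0))) ∂P := by
        refine lintegral_mono_ae ?_
        filter_upwards [hE] with ω hω
        exact lintegral_mono fun u => hω u
    _ = ∫⁻ u in A, ∫⁻ ω, (ENNReal.ofReal (V u) * ENNReal.ofReal (W ω u) +
        25 * (S.indicator 1 ω + ∑' k : ℕ,
          if ((k : ℝ) + 1) * h ≤ |u| then (B k).indicator 1 ω else 0)) ∂P :=
        lintegral_lintegral_swap hm.aemeasurable
    _ ≤ _ := by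
        refine lintegral_mono fun u => ?_
        have hWu : Measurable fun ω => ENNReal.ofReal (W ω u) :=
          (hW.comp (measurable_id.prodMk measurable_const)).ennreal_ofReal
        have hBu : ∀ k : ℕ, Measurable fun ω =>
            if ((k : ℝ) + 1) * h ≤ |u| then (B k).indicator (1 : Ω → ℝ≥0∞) ω else 0 := fun k =>
          (hmB k).comp (measurable_id.prodMk measurable_const)
        have hSu : Measurable fun ω => S.indicator (1 : Ω → ℝ≥0∞) ω := measurable_one.indicator hS
        have hBP : ∀ k : ℕ, ∫⁻ ω, (if ((k : ℝ) + 1) * h ≤ |u| then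
            (B k).indicator (1 : Ω → ℝ≥0∞) ω else 0) ∂P
            ≤ if ((k : ℝ) + 1) * h ≤ |u| then ENNReal.ofReal p else 0 := by
          intro k
          split_ifs
          · rw [lintegral_indicator_one (hB k)]
            exact hPB k
          · simp
        rw [lintegral_add_left (hWu.const_mul _), lintegral_const_mul _ hWu,
          lintegral_const_mul _ (by exact hSu.add (Measurable.tsum hBu)),
          lintegral_add_left hSu, lintegral_tsum fun k => (hBu k).aemeasurable,
          lintegral_indicator_one hS]
        have hw : 0 ≤ |u| / h * p := by positivity
        rw [ENNReal.ofReal_add (mul_nonneg (hV0 u) (hR0 u)) (by positivity),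
          ENNReal.ofReal_mul (hV0 u), ENNReal.ofReal_mul (by norm_num), ENNReal.ofReal_add hs hw,
          ENNReal.ofReal_ofNat]
        gcongr
        · exact hR u
        · exact (ENNReal.tsum_le_tsum hBP).trans (tsum_ite_grid_le hh (abs_nonneg u) hp)

lemma measurable_uncurry_ecf {n : ℕ} {Y : Ω → Fin n → ℝ} (hY : ∀ j, Measurable fun ω => Y ω j) :
    Measurable fun q : Ω × ℝ => ecf (Y q.1) q.2 := by
  unfold ecf
  refine (Finset.measurable_sum _ fun j _ => ?_).const_mul _
  have h1 : Measurable fun q : Ω × ℝ => (Y q.1 j : ℂ) :=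
    Complex.measurable_ofReal.comp ((hY j).comp measurable_fst)
  fun_prop

lemma measurable_norm_ecf_sub {n : ℕ} {Y : Ω → Fin n → ℝ} (hY : ∀ j, Measurable fun ω => Y ω j)
    (u : ℝ) (z : ℂ) : Measurable fun ω => ‖ecf (Y ω) u - z‖ := by
  have h1 := (measurable_uncurry_ecf hY).comp (measurable_prodMk_right (y := u))
  exact (h1.sub_const z).norm

lemma measurable_sum_abs_jumps {N : Ω → ℕ} {X : ℕ → Ω → ℝ} (hN : Measurable N)
    (hX : ∀ j, Measurable (X j)) :
    Measurable fun ω => ∑ i ∈ Finset.range (N ω), |X i ω| :=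
  measurable_sum_range.comp ((measurable_pi_lambda _ fun j => (hX j).abs).prodMk hN)

variable {N : ℝ≥0 → Ω → ℕ} {X : ℕ → Ω → ℝ} {f : ℝ → ℝ}

/-- The integrated risk of the spectral estimator on the Fourier side. -/
lemma lintegral_lintegral_phiTilde_sub_sq_le (hpair : IsCompoundPoissonPair N X 1 f P)
    (hν : MemLp id 2 (lawOfDensity f)) {a : ℝ}
    (ha : ∀ u, 1 - (charFun (lawOfDensity f) u).re ≤ a) {n : ℕ} (hn : n ≠ 0) {Δ : ℝ≥0}
    (hΔ : 0 < Δ) (hrate : 16 * (2 * ∫ x, |x| ∂(lawOfDensity f) + 1) * Δ * Real.exp (a * Δ) *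
      Real.exp (-(n * Real.exp (-(2 * a * Δ)) / 128)) ≤ 8 / (n * (Δ : ℝ)) ^ 2) (A : Set ℝ) :
    ∫⁻ ω, (∫⁻ u in A, ‖phiTilde Δ (increments (compoundProcess N X) Δ n ω) u
        - charFun (lawOfDensity f) u‖ₑ ^ 2) ∂P
      ≤ ∫⁻ u in A, ENNReal.ofReal
        (9 / (n * (Δ : ℝ)) * (1 / ‖Complex.exp (Δ * (charFun (lawOfDensity f) u - 1))‖ ^ 2)
          + 25 * ((∫ x, x ^ 2 ∂(lawOfDensity f)) / (n * (Δ : ℝ)))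
          + 200 / (n * (Δ : ℝ)) ^ 2 * |u|) := by
  have hprob : IsProbabilityMeasure (lawOfDensity f) := by
    rw [← hpair.law_jump 0]
    exact Measure.isProbabilityMeasure_map (hpair.measurable_jump 0).aemeasurable
  have hν1 : MemLp id 1 (lawOfDensity f) := hν.mono_exponent (by norm_num)
  have hΔ' : (0 : ℝ) < Δ := hΔ
  have hn' : (0 : ℝ) < n := by exact_mod_cast Nat.pos_of_ne_zero hn
  set ν := lawOfDensity f
  set M := ∫ x, |x| ∂ν
  have hM : 0 ≤ M := integral_nonneg fun x => abs_nonneg x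
  set Y : Ω → Fin n → ℝ := fun ω => increments (compoundProcess N X) Δ n ω
  set ψ : ℝ → ℂ := fun u => Complex.exp (Δ * (charFun ν u - 1))
  have hYm : ∀ j, Measurable fun ω => Y ω j := measurable_increments hpair Δ n
  have hYi : iIndepFun (fun j ω => Y ω j) P := iIndepFun_increments hpair Δ n
  have hYψ : ∀ j u, charFun (P.map fun ω => Y ω j) u = ψ u := fun j u =>
    charFun_increments hpair Δ n j u
  have hψc : Continuous ψ := by
    have := continuous_charFun (μ := ν)
    fun_prop
  have hψpos : ∀ u, 0 < ‖ψ u‖ := fun u => norm_pos_iff.2 (Complex.exp_ne_zero _)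
  set ε := Real.exp (-(a * Δ)) / 4 with hε
  set h := ε / (Δ * (2 * M + 1)) with hh
  have hεpos : 0 < ε := by positivity
  have hhpos : 0 < h := by positivity
  set p := 4 * Real.exp (-(n * ε ^ 2 / 8))
  set s := (∫ x, x ^ 2 ∂ν) / (n * (Δ : ℝ))
  have hs : 0 ≤ s := div_nonneg (integral_nonneg fun x => sq_nonneg x) (by positivity)
  set S : Set Ω := {ω | ((n * Δ : ℝ≥0) : ℝ) * (M + 1) ≤
    ∑ i ∈ Finset.range (N (n * Δ) ω), |X i ω|}
  set B : ℕ → Set Ω := fun k => {ω | ε < ‖ecf (Y ω) ((k + 1) * h) - ψ ((k + 1) * h)‖}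
  set W : Ω → ℝ → ℝ := fun ω u => ‖ecf (Y ω) u - ψ u‖ ^ 2
  set V : ℝ → ℝ := fun u => 9 / 4 * (Δ : ℝ)⁻¹ ^ 2 * (1 / ‖ψ u‖ ^ 2)
  have hecf : Measurable fun q : Ω × ℝ => ‖ecf (Y q.1) q.2 - ψ q.2‖ :=
    ((measurable_uncurry_ecf hYm).sub (hψc.measurable.comp measurable_snd)).norm
  have hW : Measurable (Function.uncurry W) := hecf.pow_const 2
  have hV : Measurable V := by
    have := hψc.measurable.norm
    fun_prop
  have hSm : MeasurableSet S :=
    measurableSet_le measurable_const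
      (measurable_sum_abs_jumps (hpair.poisson.measurable _) hpair.measurable_jump)
  have hBm : ∀ k, MeasurableSet (B k) := fun k =>
    measurableSet_lt measurable_const (measurable_norm_ecf_sub hYm _ _)
  have hE : ∀ᵐ ω ∂P, ∀ u, ‖phiTilde Δ (Y ω) u - charFun ν u‖ₑ ^ 2 ≤
      ENNReal.ofReal (V u) * ENNReal.ofReal (W ω u) + 25 * (S.indicator 1 ω +
        ∑' k : ℕ, if ((k : ℝ) + 1) * h ≤ |u| then (B k).indicator 1 ω else 0) := by
    filter_upwards [sum_abs_increments_le hpair Δ n] with ω hω u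
    -- `25 = (4 + 1)²`: the truncation level plus the bound on `φ`.
    have h25 : ‖phiTilde Δ (Y ω) u - charFun ν u‖ₑ ^ 2 ≤ 25 := by
      have : ‖phiTilde Δ (Y ω) u - charFun ν u‖ ≤ 5 := by
        linarith [norm_sub_le (phiTilde Δ (Y ω) u) (charFun ν u), norm_phiTilde_le (Y ω) Δ u,
          norm_charFun_le_one (μ := ν) u]
      rw [← ofReal_norm, ← ENNReal.ofReal_pow (norm_nonneg _), ← ENNReal.ofReal_ofNat 25]
      refine ENNReal.ofReal_le_ofReal ?_
      nlinarith [norm_nonneg (phiTilde Δ (Y ω) u - charFun ν u)]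
    by_cases hωS : ω ∈ S
    · refine h25.trans (le_add_left ?_)
      rw [Set.indicator_of_mem hωS, Pi.one_apply]
      nth_rewrite 1 [← mul_one 25]
      gcongr
      exact le_self_add
    by_cases hωB : ∃ k : ℕ, ((k : ℝ) + 1) * h ≤ |u| ∧ ω ∈ B k
    · obtain ⟨k, hk, hkB⟩ := hωB
      refine h25.trans (le_add_left ?_)
      nth_rewrite 1 [← mul_one 25]
      gcongr
      refine le_add_left (le_trans ?_ (ENNReal.le_tsum k))
      rw [if_pos hk, Set.indicator_of_mem hkB, Pi.one_apply]
    · refine le_add_right ?_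
      have hy : (n : ℝ)⁻¹ * ∑ j, |Y ω j| ≤ Δ * (M + 1) := by
        have h1 : ∑ i ∈ Finset.range (N (n * Δ) ω), |X i ω| < n * Δ * (M + 1) := by
          simpa [S] using hωS
        rw [inv_mul_le_iff₀ hn', ← mul_assoc]
        exact hω.trans h1.le
      have key := norm_phiTilde_sub_le_of_grid hν1 ha hn hΔ' hy (u := u) hh fun k hk => by
        by_contra hcon
        exact hωB ⟨k, hk, not_le.1 hcon⟩
      rw [← ENNReal.ofReal_mul (by positivity), ← ofReal_norm,
        ← ENNReal.ofReal_pow (norm_nonneg _)]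
      refine ENNReal.ofReal_le_ofReal ((pow_le_pow_left₀ (norm_nonneg _) key 2).trans_eq ?_)
      simp only [V, W, ψ]
      ring
  have hR : ∀ u, ∫⁻ ω, ENNReal.ofReal (W ω u) ∂P ≤ ENNReal.ofReal (4 * Δ / n) := fun u => by
    rw [lintegral_norm_ecf_sub_sq hYm hYi hYψ hn u]
    refine ENNReal.ofReal_le_ofReal ?_
    gcongr
    exact one_sub_norm_cexp_charFun_sq_le hΔ'.le u
  have hPS : P S ≤ ENNReal.ofReal s := by
    have := measure_sum_abs_jumps_ge_le hpair hν (t := n * Δ)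
      (mul_pos (by exact_mod_cast Nat.pos_of_ne_zero hn) hΔ)
    simpa [s, S, M, ν] using this
  have hPB : ∀ k, P (B k) ≤ ENNReal.ofReal p := fun k =>
    measure_norm_ecf_sub_gt_le hYm hYi hYψ hn _ hεpos.le
  refine (lintegral_lintegral_error_le hW hV hSm hBm hE hhpos hs (by positivity)
    (fun u => by positivity) hR (fun u => by positivity) hPS hPB A).trans ?_
  refine lintegral_mono fun u => ENNReal.ofReal_le_ofReal ?_
  have hgrid : |u| / h * p ≤ 8 / (n * (Δ : ℝ)) ^ 2 * |u| := by
    have e1 : |u| / h * p = 16 * (2 * M + 1) * Δ * Real.exp (a * Δ) *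
        Real.exp (-(n * Real.exp (-(2 * a * Δ)) / 128)) * |u| := by
      have e2 : (n : ℝ) * ε ^ 2 / 8 = n * Real.exp (-(2 * a * Δ)) / 128 := by
        rw [hε, div_pow, ← Real.exp_nat_mul]
        push_cast
        ring_nf
      simp only [p, e2, hh]
      rw [hε, Real.exp_neg (a * Δ)]
      field_simp
      norm_num
    rw [e1]
    gcongr
  have hfirst : V u * (4 * Δ / n) = 9 / (n * (Δ : ℝ)) * (1 / ‖ψ u‖ ^ 2) := by
    simp only [V]
    field_simp
  rw [hfirst, mul_add, ← add_assoc]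
  have : 25 * (|u| / h * p) ≤ 200 / (n * (Δ : ℝ)) ^ 2 * |u| := by
    calc _ ≤ 25 * (8 / (n * (Δ : ℝ)) ^ 2 * |u|) := by gcongr
      _ = _ := by ring
  linarith

end Risk

end Decompounding

theorem theorem2 (f : ℝ → ℝ) (hf_meas : Measurable f) (hf_nonneg : ∀ x, 0 ≤ f x)
    (hf_one : ∫ x, f x = 1) (hf_sq : Integrable fun x => x ^ 2 * f x) :
    ∃ T₀ : ℝ, ∀ (Ω : Type*) [MeasurableSpace Ω] (P : Measure Ω) [IsProbabilityMeasure P]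
      (N : ℝ≥0 → Ω → ℕ) (X : ℕ → Ω → ℝ),
      Decompounding.IsCompoundPoissonPair N X 1 f P →
      ∀ (n : ℕ) (Δ : ℝ≥0), 0 < Δ → T₀ ≤ n * (Δ : ℝ) →
        (Δ : ℝ) ≤ 1 / 4 * Real.log (n * (Δ : ℝ)) →
      ∀ m : ℝ, 0 ≤ m →
        ∫⁻ ω, Decompounding.sqDist
            (Decompounding.fHat (Δ : ℝ)
              (Decompounding.increments (Decompounding.compoundProcess N X) Δ n ω) m) f ∂P
          ≤ Decompounding.sqDist (Decompounding.fCut f m) f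
            + ENNReal.ofReal
              (2 / (n * (Δ : ℝ))
                  * (∫ u in (-m)..m,
                      1 / ‖charFun (P.map (Decompounding.compoundProcess N X Δ)) u‖ ^ 2)
                + 50 * (∫ x, x ^ 2 * f x) * (m / (n * (Δ : ℝ)))
                + 200 * (m ^ 2 / (n * (Δ : ℝ)) ^ 2)) := by
  open Decompounding in
  have hprob := isProbabilityMeasure_lawOfDensity hf_nonneg hf_one
  have hν := memLp_id_lawOfDensity hf_meas hf_nonneg hf_sq
  obtain ⟨a, ha0, ha2, ha⟩ := exists_one_sub_re_charFun_le hf_meas hf_nonneg hf_one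
  have hM : 0 ≤ ∫ x, |x| ∂(lawOfDensity f) := integral_nonneg fun x => abs_nonneg x
  -- The threshold is fixed by `a` and by `L`, the Lipschitz constant on the good event divided by
  -- `Δ`. Both depend on `f` alone.
  obtain ⟨T₀, hT₀, hrate⟩ := exists_threshold ha0 ha2
    (L := 2 * ∫ x, |x| ∂(lawOfDensity f) + 1) (by positivity)
  refine ⟨T₀, fun Ω _ P _ N X hpair n Δ hΔ hT hΔT m hm => ?_⟩
  have hTpos : 0 < n * (Δ : ℝ) := by linarith
  have hn : n ≠ 0 := by
    rintro rfl
    simp at hTpos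
  have hφ : fourierTransform f = charFun (lawOfDensity f) :=
    fourierTransform_eq_charFun hf_meas hf_nonneg
  have hφm : Measurable (fourierTransform f) := hφ ▸ continuous_charFun.measurable
  have hφ1 : ∀ u, ‖fourierTransform f u‖ ≤ 1 := fun u => hφ ▸ norm_charFun_le_one u
  have hψc : Continuous fun u =>
      1 / ‖Complex.exp (Δ * (charFun (lawOfDensity f) u - 1))‖ ^ 2 := by
    have := continuous_charFun (μ := lawOfDensity f)
    refine Continuous.div continuous_const (by fun_prop) fun u => ?_
    exact pow_ne_zero 2 (norm_ne_zero_iff.2 (Complex.exp_ne_zero _))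
  simp only [charFun_compoundProcess hpair]
  rw [← integral_sq_lawOfDensity hf_meas hf_nonneg]
  calc _ ≤ ∫⁻ ω, (sqDist (fCut f m) f + ENNReal.ofReal (2 * Real.pi)⁻¹ *
        ∫⁻ u in Set.Ioc (-m) m, ‖phiTilde Δ (increments (compoundProcess N X) Δ n ω) u
          - fourierTransform f u‖ₑ ^ 2) ∂P := lintegral_mono fun ω =>
        sqDist_cutoffInverse_le (integrable_of_integral_eq_one hf_one) hφm hφ1
          (measurable_phiTilde _ _) (norm_phiTilde_le _ _) hm
    _ = sqDist (fCut f m) f + ENNReal.ofReal (2 * Real.pi)⁻¹ *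
        ∫⁻ ω, (∫⁻ u in Set.Ioc (-m) m, ‖phiTilde Δ (increments (compoundProcess N X) Δ n ω) u
          - charFun (lawOfDensity f) u‖ₑ ^ 2) ∂P := by
        rw [lintegral_add_left measurable_const, lintegral_const, measure_univ, mul_one,
          lintegral_const_mul' _ _ ENNReal.ofReal_ne_top, hφ]
    _ ≤ _ := by
        gcongr
        refine le_trans ?_ (ofReal_mul_setLIntegral_le hψc hTpos (fun u => by positivity)
          (integral_nonneg fun x => sq_nonneg x) hm)
        gcongr
        exact lintegral_lintegral_phiTilde_sub_sq_le hpair hν ha hn hΔ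
          (hrate n Δ hΔ hT hΔT) _
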